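/- Let $b$ be a prime, let $\mathbb N=\{1,2,\dots\}$ and let $\alpha\ge 2$ be an integer. For $x\in[0,1)$ let $(\mathsf x_\ell)_{\ell\ge1}$ be the digits of its base-$b$ expansion $x=\sum_{\ell\ge1}\mathsf x_\ell b^{-\ell}$ that does not end in an infinite trail of digits $b-1$. For $x,y\in[0,1)$ let $x\oplus y=\sum_{\ell\ge1}\big((\mathsf x_\ell+\mathsf y_\ell)\bmod b\big)b^{-\ell}$, and let $x\ominus y$ be the digit sequence $\big((\mathsf x_\ell-\mathsf y_\ell)\bmod b\big)_{\ell\ge1}$. For $k=\sum_{\ell\ge0}\mathsf k_\ell b^\ell\in\mathbb N$ and a digit sequence $d=(d_\ell)_{\ell\ge1}$ put $\mathrm{wal}_k(d)=\exp\big(\tfrac{2\pi\sqrt{-1}}{b}\sum_{\ell\ge0}\mathsf k_\ell d_{\ell+1}\big)$. If the nonzero base-$b$ digits of $k$ are at the positions $a_1>\dots>a_{\#k}\ge0$ (the position of the digit multiplying $b^a$ being $a$), put $$\mathring\mu_\alpha(k)=\sum_{\ell=1}^{\min(\alpha,\#k)}(a_\ell+1)+\max(\alpha-\#k,0)\,(a_{\#k}+1).$$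 Consider the following kernels on $[0,1)\times[0,1)$: $$\widetilde K_\alpha(x,x')=\sum_{k\in\mathbb Z\setminus\{0\}}k^{-2\alpha}\cos(2\pi k(x-x')),\qquad \widetilde K_\alpha^{\mathrm{DSI}}(x,x')=\int_0^1\widetilde K_\alpha(x\oplus\sigma,x'\oplus\sigma)\,\mathrm d\sigma,$$ $$\mathring K_\alpha(x,x')=\sum_{k\in\mathbb N}b^{-2\mathring\mu_\alpha(k)}\,\mathrm{wal}_k(x\ominus x'),\qquad \mathring{\mathring K}_\alpha(x,x')=\sum_{k\in\mathbb N}b^{-\mathring\mu_\alpha(k)}\,\mathrm{wal}_k(x\ominus x').$$ (In the integral, $\widetilde K_\alpha$ is given by the same formula on $[0,1]\times[0,1]$.) The two Walsh series converge absolutely for all $x,x'\in[0,1)$ and have real sums, and all four kernels are symmetric positive semi-definite. Denoting by $H(K)$ the set of functions $[0,1)\to\mathbb R$ in the real reproducing kernel Hilbert space with kernel $K$, we have $$H\big(\widetilde K_\alpha^{\mathrm{DSI}}\big)\subseteq H\big(\mathring K_\alpha\big)\subseteq H\big(\mathring{\mathring K}_\alpha\big)\qquad\text{and}\qquad H\big(\widetilde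 K_\alpha\big)\subseteq H\big(\mathring{\mathring K}_\alpha\big).$$ -/

import Mathlib

noncomputable section

namespace WalshRKHS

/-! ### Reproducing kernel Hilbert spaces as sets of functions -/

/-- The set of functions `H(K)`: all functions belonging to a real Hilbert space of functions on `X`
with continuous point evaluations whose reproducing kernel is `K`. For a symmetric positive
semi-definite `K` such a Hilbert space exists and is unique (Moore–Aronszajn). -/
def rkhs {X : Type} (K : X → X → ℝ) : Set (X → ℝ) :=
  {f | ∃ (H : Type) (_ : NormedAddCommGroup H) (_ : InnerProductSpace ℝ H) (_ : CompleteSpace H)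
      (_ : RKHS ℝ H X ℝ), (∀ x y, RKHS.kernel H x y 1 = K x y) ∧ ∃ g : H, ⇑g = f}

/-- The half-open unit interval `[0,1)`. -/
abbrev I : Type := Set.Ico (0 : ℝ) 1

/-- The restriction of a kernel to `[0,1) × [0,1)`. -/
def onI (K : ℝ → ℝ → ℝ) : I → I → ℝ := fun x y => K x y

/-- Symmetric and positive semi-definite as a kernel on `[0,1)`. -/
def IsSPSD (K : ℝ → ℝ → ℝ) : Prop := (Matrix.of (onI K)).PosSemidef

/-- The set of functions `[0,1) → ℝ` in the reproducing kernel Hilbert space of `K` on `[0,1)`. -/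
def H (K : ℝ → ℝ → ℝ) : Set (I → ℝ) := rkhs (onI K)

/-! ### Base-`b` digits, digital shifts and Walsh functions -/

/-- Digit-wise addition modulo `b` of the base-`b` expansions of two points of `[0,1)`. -/
def digitAdd (b : ℕ) [NeZero b] (x y : ℝ) : ℝ :=
  Real.ofDigits (Real.digits x b + Real.digits y b)

/-- Digit-wise subtraction modulo `b`. The result is kept as a digit sequence and not collapsed to a
real number: it may end in an infinite trail of the digit `b - 1`, and the Walsh functions are
characters of the group of digit sequences. -/
def digitSub (b : ℕ) [NeZero b] (x y : ℝ) : ℕ → Fin b :=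
  Real.digits x b - Real.digits y b

/-- The digit of `k` at `b ^ a`. -/
def natDigit (b k a : ℕ) : ℕ := k / b ^ a % b

/-- The `k`-th base-`b` Walsh function, as a function of the digits `d 0, d 1, …` after the radix
point. All digits of `k` at positions `≥ k` vanish when `2 ≤ b`. -/
def wal (b k : ℕ) (d : ℕ → Fin b) : ℂ :=
  Complex.exp (2 * Real.pi * Complex.I / b *
    ((∑ l ∈ Finset.range k, natDigit b k l * (d l : ℕ) : ℕ) : ℂ))

/-! ### Dick weights -/

/-- For `k = ∑ₗ 𝗄_{aₗ} b ^ aₗ` with `a₁ > ⋯ > a_{#k}` and nonzero digits `𝗄_{aₗ}`, the list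
`[a₁ + 1, …, a_{#k} + 1]` (empty for `k = 0`). -/
def positions (b k : ℕ) : List ℕ :=
  ((List.range k).reverse.filter fun a => natDigit b k a ≠ 0).map (· + 1)

/-- `μ_α(k) = ∑_{ℓ = 1}^{min(α, #k)} (aₗ + 1)`. -/
def mu (b α k : ℕ) : ℕ := ((positions b k).take α).sum

/-- `μ̊_α(k) = μ_α(k) + max(α - #k, 0) (a_{#k} + 1)`, equal to `0` for `k = 0`
(natural-number subtraction is the maximum with `0`). -/
def muRing (b α k : ℕ) : ℕ :=
  mu b α k + (α - (positions b k).length) * (positions b k).getLastD 0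

/-! ### Kernels -/

/-- The Korobov kernel `K̃_α(x, x') = ∑_{k ∈ ℤ \ {0}} k ^ (-2α) cos(2πk(x - x'))`. -/
def korobov (α : ℕ) (x x' : ℝ) : ℝ :=
  ∑' k : {k : ℤ // k ≠ 0}, ((k : ℝ) ^ (2 * α))⁻¹ * Real.cos (2 * Real.pi * k * (x - x'))

/-- The digitally-shift-invariant kernel associated with `K`:
`K^DSI(x, x') = ∫₀¹ K(x ⊕ σ, x' ⊕ σ) dσ`. -/
def dsi (b : ℕ) [NeZero b] (K : ℝ → ℝ → ℝ) (x x' : ℝ) : ℝ :=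
  ∫ σ in (0 : ℝ)..1, K (digitAdd b x σ) (digitAdd b x' σ)

/-- The term `r²(k) wal_k(x ⊖ x')` of a Walsh kernel, for `k` in the positive integers. -/
def walshTerm (b : ℕ) [NeZero b] (r2 : ℕ → ℝ) (x x' : ℝ) (k : ℕ+) : ℂ :=
  (r2 k : ℂ) * wal b k (digitSub b x x')

/-- The Walsh kernel `K(x, x') = ∑_{k ≥ 1} r²(k) wal_k(x ⊖ x')` with weights `r²`. It is used only
for weights for which the series converges to a real number. -/
def walshKernel (b : ℕ) [NeZero b] (r2 : ℕ → ℝ) (x x' : ℝ) : ℝ :=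
  (∑' k : ℕ+, walshTerm b r2 x x' k).re

/-- `r̊_α²(k) = b ^ (-2 μ̊_α(k))`. -/
def rRing2 (b α k : ℕ) : ℝ := ((b : ℝ) ^ (2 * muRing b α k))⁻¹

/-- `r̊̊_α²(k) = b ^ (-μ̊_α(k))`. -/
def rRingRing2 (b α k : ℕ) : ℝ := ((b : ℝ) ^ muRing b α k)⁻¹

/-- `K̊_α`. -/
def kRing (b : ℕ) [NeZero b] (α : ℕ) : ℝ → ℝ → ℝ := walshKernel b (rRing2 b α)

/-- `K̊̊_α`. -/
def kRingRing (b : ℕ) [NeZero b] (α : ℕ) : ℝ → ℝ → ℝ := walshKernel b (rRingRing2 b α)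

end WalshRKHS

end

noncomputable section

namespace WalshRKHS

open Filter Topology MeasureTheory
open scoped InnerProductSpace

/-! ### Inclusions of reproducing kernel Hilbert spaces -/

/-! By Aronszajn's criterion `rkhs_subset_of_quadForm_le`, an inclusion `H(K₁) ⊆ H(K₂)` follows from
`K₁ ≤ C K₂` in the sense of quadratic forms, so each inclusion becomes an inequality for finitely
supported `a`. Write `â(k) = ∑ₓ a(x) wal_k(x)`. A Walsh kernel has the form `∑_{k ≥ 1} r²(k)
|â(k)|²`, and the Korobov kernel has the form `∑_h h^(-2α) |∑ₓ a(x) e(hx)|²`. The inclusion between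
the two Walsh kernels is then the termwise bound `b^(-2μ̊) ≤ b^(-μ̊)`.

To compare Korobov with Walsh, round points down to `n` digits. Then `e(hx)` is a product over the
digits, hence a finite Walsh sum over `k < b^n` whose coefficients `walshCoeff b n h k` are products
of one-digit Fourier coefficients. The central estimate is `walshMass_le`: for `k ≠ 0`, `∑_h h^(-2α)
|walshCoeff b n h k|²` is at most a constant times `b^(-2μ̊_α(k))`, uniformly in `n`. A factor at a
nonzero digit in position `a` is `O(|h| / b^a)`; the `min(α, #k)` highest ones absorb that many
powers of `|h|⁻¹`. If `#k < α`, vanishing low digits force `b^m ∣ h`, with `m` the lowest nonzero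
position, which pays for the remaining powers. The digits below `m` leave a `b^m`-periodic factor of
mean square `b^(-m)`, so the sum over `h` costs only a constant.

Averaging over digital shifts makes the Korobov form diagonal, with entries `walshMass b α n k`, so
the estimate gives the weights `b^(-2μ̊)`. Without averaging, Cauchy–Schwarz with weights `b^(-μ̊)`
handles the cross terms; this loses half of the exponent and needs `∑ b^(-μ̊) < ∞`, which holds for
`α ≥ 2`. The index `k = 0`, absent from the Walsh kernels, appears only through rounding and
vanishes as `n → ∞`. -/

/-- The quadratic form of a kernel. -/
def quadForm {X : Type} (K : X → X → ℝ) (a : X →₀ ℝ) : ℝ :=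
  ∑ x ∈ a.support, ∑ y ∈ a.support, a x * a y * K x y

theorem posSemidef_of_quadForm_nonneg {X : Type} {K : X → X → ℝ} (hs : ∀ x y, K x y = K y x)
    (h : ∀ a, 0 ≤ quadForm K a) : (Matrix.of K).PosSemidef := by
  refine ⟨?_, fun a => ?_⟩
  · ext x y; simp [hs x y]
  · have := h a
    simp only [quadForm] at this
    simp only [Finsupp.sum, Matrix.of_apply, star_trivial]
    exact this.trans_eq (Finset.sum_congr rfl fun x _ => Finset.sum_congr rfl fun y _ => by ring)

theorem quadForm_nonneg {X : Type} {K : X → X → ℝ} (h : (Matrix.of K).PosSemidef) (a : X →₀ ℝ) :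
    0 ≤ quadForm K a := by
  have := h.2 a
  simp only [Finsupp.sum, Matrix.of_apply, star_trivial] at this
  simp only [quadForm]
  exact this.trans_eq (Finset.sum_congr rfl fun x _ => Finset.sum_congr rfl fun y _ => by ring)

/-- Moore's theorem for real-valued kernels. -/
theorem exists_rkhs {X : Type} {K : X → X → ℝ} (hK : (Matrix.of K).PosSemidef) :
    ∃ (H : Type) (_ : NormedAddCommGroup H) (_ : InnerProductSpace ℝ H) (_ : CompleteSpace H)
      (_ : RKHS ℝ H X ℝ), ∀ x y, RKHS.kernel H x y 1 = K x y := by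
  -- The construction of the Hilbert space takes operator-valued kernels; a real kernel acts by
  -- scalar multiplication on `ℝ`.
  let M : Matrix X X (ℝ →L[ℝ] ℝ) := .of fun x y => K x y • ContinuousLinearMap.id ℝ ℝ
  have hsymm : ∀ x y, K x y = K y x := fun x y => by
    have := hK.1.apply x y
    simpa using this.symm
  have hM : M.PosSemidef := by
    have key := ((RKHS.posSemidef_tfae (K := M)).out 0 2).mpr
    refine key ⟨?_, fun v => ?_⟩
    · ext x y
      have : star (ContinuousLinearMap.id ℝ ℝ) = ContinuousLinearMap.id ℝ ℝ :=
        star_one (ℝ →L[ℝ] ℝ)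
      simp [M, hsymm x y, this]
    · have := quadForm_nonneg hK v
      simp only [quadForm] at this
      simp only [Finsupp.sum, RCLike.re_to_real]
      convert this using 4 with x _ y _
      simp [M, hsymm x y]
      ring
  have : Fact M.PosSemidef := ⟨hM⟩
  refine ⟨RKHS.OfKernel M, inferInstance, inferInstance, inferInstance, inferInstance, ?_⟩
  intro x y
  rw [RKHS.OfKernel.kernel_ofKernel]
  simp [M]

section

variable {X H : Type} [NormedAddCommGroup H] [InnerProductSpace ℝ H] [CompleteSpace H]
  [RKHS ℝ H X ℝ]

variable (H) in
/-- The linear combination of kernel functions with given coefficients. -/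
def kerComb : (X →₀ ℝ) →ₗ[ℝ] H := Finsupp.linearCombination ℝ fun x => RKHS.kerFun H x 1

theorem inner_kerComb (g : H) (a : X →₀ ℝ) :
    ⟪g, kerComb H a⟫_ℝ = ∑ x ∈ a.support, a x * g x := by
  simp [kerComb, Finsupp.linearCombination_apply, Finsupp.sum, inner_sum, inner_smul_right]

theorem norm_kerComb_sq {K : X → X → ℝ} (hK : ∀ x y, RKHS.kernel H x y 1 = K x y) (a : X →₀ ℝ) :
    ‖kerComb H a‖ ^ 2 = quadForm K a := by
  rw [← real_inner_self_eq_norm_sq, inner_kerComb, quadForm]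
  refine Finset.sum_congr rfl fun x _ => ?_
  have : kerComb H a x = ∑ y ∈ a.support, a y * K x y := by
    have h1 : kerComb H a x = ⟪RKHS.kerFun H x (1 : ℝ), kerComb H a⟫_ℝ := by simp
    rw [h1, inner_kerComb]
    refine Finset.sum_congr rfl fun y _ => ?_
    have h2 : RKHS.kerFun H x (1 : ℝ) y = ⟪RKHS.kerFun H y (1 : ℝ), RKHS.kerFun H x (1 : ℝ)⟫_ℝ := by
      rw [RKHS.kerFun_inner]; simp
    have h3 : RKHS.kerFun H y (1 : ℝ) x = ⟪RKHS.kerFun H x (1 : ℝ), RKHS.kerFun H y (1 : ℝ)⟫_ℝ := by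
      rw [RKHS.kerFun_inner]; simp
    rw [h2, real_inner_comm, ← h3, RKHS.kerFun_apply, hK]
  rw [this, Finset.mul_sum]
  exact Finset.sum_congr rfl fun y _ => by ring

variable (H) in
theorem denseRange_kerComb : DenseRange (kerComb H : (X →₀ ℝ) → H) := by
  have h := RKHS.kerFun_dense (𝕜 := ℝ) (V := ℝ) (X := X) H
  have h2 : Submodule.span ℝ {RKHS.kerFun H x v | (x : X) (v : ℝ)} ≤
      LinearMap.range (kerComb (X := X) H) := by
    rw [Submodule.span_le]
    rintro _ ⟨x, v, rfl⟩
    refine ⟨Finsupp.single x v, ?_⟩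
    simp [kerComb, ← map_smul]
  rw [DenseRange, ← LinearMap.coe_range, ← Submodule.dense_iff_topologicalClosure_eq_top.symm.eq]
  exact top_le_iff.mp (h ▸ Submodule.topologicalClosure_mono h2)

end

/-- Aronszajn's inclusion criterion. -/
theorem rkhs_subset_of_quadForm_le {X : Type} {K₁ K₂ : X → X → ℝ}
    (h₂ : (Matrix.of K₂).PosSemidef) {C : ℝ} (hC0 : 0 ≤ C)
    (hC : ∀ a, quadForm K₁ a ≤ C * quadForm K₂ a) : rkhs K₁ ⊆ rkhs K₂ := by
  rintro f ⟨H₁, _, _, _, _, hK₁, g, rfl⟩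
  obtain ⟨H₂, i₁, i₂, i₃, i₄, hK₂⟩ := exists_rkhs h₂
  refine ⟨H₂, i₁, i₂, i₃, i₄, hK₂, ?_⟩
  have hb : ∀ a, ‖kerComb H₁ a‖ ≤ √C * ‖kerComb H₂ a‖ := fun a => by
    refine abs_le_of_sq_le_sq' ?_ (by positivity) |>.2
    rw [mul_pow, Real.sq_sqrt hC0, norm_kerComb_sq hK₁, norm_kerComb_sq hK₂]
    exact hC a
  -- `S` sends the kernel function of `K₂` at `x` to that of `K₁`. The form inequality makes it well
  -- defined and bounded. Its adjoint preserves point values: `(S* g)(x) = ⟪g, S k₂ₓ⟫ = ⟪g, k₁ₓ⟫ =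
  -- g(x)`.
  let S : H₂ →L[ℝ] H₁ := (kerComb H₁).extendOfNorm (kerComb H₂)
  have hS : ∀ a, S (kerComb H₂ a) = kerComb H₁ a :=
    fun a => LinearMap.extendOfNorm_eq (denseRange_kerComb H₂) ⟨_, hb⟩ a
  refine ⟨S.adjoint g, funext fun x => ?_⟩
  have h1 : S.adjoint g x = ⟪S.adjoint g, kerComb H₂ (Finsupp.single x 1)⟫_ℝ := by
    simp [kerComb]
  rw [h1, ContinuousLinearMap.adjoint_inner_left, hS]
  simp [kerComb]

/-! ### Exponentials and digits -/

/-- `e(t) = exp(2πit)`. -/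
def e (t : ℝ) : ℂ := Complex.exp (2 * Real.pi * Complex.I * t)

theorem e_add (s t : ℝ) : e (s + t) = e s * e t := by
  simp [e, ← Complex.exp_add]; ring_nf

theorem e_zero : e 0 = 1 := by simp [e]

theorem e_intCast (m : ℤ) : e m = 1 := by
  rw [e, Complex.exp_eq_one_iff]
  exact ⟨m, by push_cast; ring⟩

theorem e_eq_one_iff {t : ℝ} : e t = 1 ↔ ∃ m : ℤ, t = m := by
  refine ⟨fun h => ?_, ?_⟩
  · obtain ⟨m, hm⟩ := Complex.exp_eq_one_iff.mp h
    refine ⟨m, ?_⟩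
    have h2 : (2 * Real.pi * Complex.I : ℂ) ≠ 0 := by simp [Real.pi_ne_zero]
    have h3 : (2 * Real.pi * Complex.I : ℂ) * t = (2 * Real.pi * Complex.I) * m := by
      rw [hm]; ring
    exact_mod_cast mul_left_cancel₀ h2 h3
  · rintro ⟨m, rfl⟩; exact e_intCast m

theorem e_add_intCast (t : ℝ) (m : ℤ) : e (t + m) = e t := by rw [e_add, e_intCast, mul_one]

theorem e_eq_of_sub_intCast {s t : ℝ} (m : ℤ) (h : s = t + m) : e s = e t := by
  rw [h, e_add_intCast]

theorem norm_e (t : ℝ) : ‖e t‖ = 1 := by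
  have : e t = Complex.exp ((2 * Real.pi * t : ℝ) * Complex.I) := by
    rw [e]; push_cast; ring_nf
  rw [this, Complex.norm_exp_ofReal_mul_I]

theorem conj_e (t : ℝ) : (starRingEnd ℂ) (e t) = e (-t) := by
  rw [e, e, ← Complex.exp_conj]
  congr 1
  simp only [map_mul, Complex.conj_ofReal, Complex.conj_I, map_ofNat]
  push_cast
  ring

theorem e_sum {ι : Type*} (s : Finset ι) (f : ι → ℝ) : e (∑ i ∈ s, f i) = ∏ i ∈ s, e (f i) := by
  classical
  induction s using Finset.induction_on with
  | empty => simp [e_zero]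
  | insert i s hi ih => rw [Finset.sum_insert hi, Finset.prod_insert hi, e_add, ih]

theorem e_nat_mul (n : ℕ) (t : ℝ) : e (n * t) = e t ^ n := by
  simp [e, ← Complex.exp_nat_mul]; ring_nf

theorem norm_e_sub_one_le (t : ℝ) : ‖e t - 1‖ ≤ 2 * Real.pi * |t| := by
  have h := Real.norm_exp_I_mul_ofReal_sub_one_le (x := 2 * Real.pi * t)
  have h2 : e t = Complex.exp (Complex.I * (2 * Real.pi * t : ℝ)) := by
    rw [e]; push_cast; ring_nf
  rw [h2]
  refine h.trans_eq ?_
  rw [Real.norm_eq_abs, abs_mul, abs_of_pos Real.two_pi_pos]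

theorem re_e (t : ℝ) : (e t).re = Real.cos (2 * Real.pi * t) := by
  have : e t = Complex.exp ((2 * Real.pi * t : ℝ) * Complex.I) := by
    rw [e]; push_cast; ring_nf
  rw [this, Complex.exp_ofReal_mul_I_re]

/-- Orthogonality of the characters modulo `b`. -/
theorem sum_e_mul_div (b : ℕ) [NeZero b] (m : ℤ) :
    ∑ d ∈ Finset.range b, e (d * (m / b)) = if (b : ℤ) ∣ m then (b : ℂ) else 0 := by
  have hb : (b : ℝ) ≠ 0 := by exact_mod_cast NeZero.ne b
  simp only [e_nat_mul]
  split_ifs with h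
  · obtain ⟨q, rfl⟩ := h
    have : e (((b * q : ℤ) : ℝ) / b) = 1 := by
      rw [e_eq_one_iff]; exact ⟨q, by push_cast; field_simp⟩
    rw [this]; simp
  · have h1 : e ((m : ℝ) / b) ≠ 1 := by
      rw [Ne, e_eq_one_iff]
      rintro ⟨q, hq⟩
      refine h ⟨q, ?_⟩
      rw [div_eq_iff hb] at hq
      have : (m : ℝ) = ((b * q : ℤ) : ℝ) := by rw [hq]; push_cast; ring
      exact_mod_cast this
    rw [geom_sum_eq h1, ← e_nat_mul, mul_div_cancel₀ _ hb, e_intCast]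
    simp

theorem e_mul_mod_div (b : ℕ) [NeZero b] (c m : ℕ) :
    e (c * ((m % b : ℕ) : ℝ) / b) = e (c * (m : ℝ) / b) := by
  have hb : (b : ℝ) ≠ 0 := by exact_mod_cast NeZero.ne b
  symm
  refine e_eq_of_sub_intCast ((c * (m / b : ℕ) : ℕ) : ℤ) ?_
  have h : (m : ℝ) = ((m % b : ℕ) : ℝ) + b * ((m / b : ℕ) : ℝ) := by
    exact_mod_cast (Nat.mod_add_div m b).symm
  rw [Int.cast_natCast, Nat.cast_mul, h]
  field_simp

theorem natDigit_lt (b : ℕ) [NeZero b] (k j : ℕ) : natDigit b k j < b :=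
  Nat.mod_lt _ (NeZero.pos b)

theorem natDigit_eq_zero {b k n j : ℕ} (hb : 0 < b) (hk : k < b ^ n) (hj : n ≤ j) :
    natDigit b k j = 0 := by
  rw [natDigit, Nat.div_eq_of_lt (hk.trans_le (Nat.pow_le_pow_right hb hj)), Nat.zero_mod]

theorem natDigit_add_mul_of_lt {b n j : ℕ} (hb : 0 < b) (r d : ℕ) (hj : j < n) :
    natDigit b (r + b ^ n * d) j = natDigit b r j := by
  obtain ⟨i, rfl⟩ := Nat.exists_eq_add_of_lt hj
  have : b ^ (j + i + 1) * d = b ^ j * (b * (b ^ i * d)) := by ring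
  rw [natDigit, natDigit, this, Nat.add_mul_div_left _ _ (by positivity), Nat.add_mul_mod_self_left]

theorem natDigit_add_mul_self {b n r d : ℕ} (hb : 0 < b) (hr : r < b ^ n) (hd : d < b) :
    natDigit b (r + b ^ n * d) n = d := by
  rw [natDigit, Nat.add_mul_div_left _ _ (by positivity), Nat.div_eq_of_lt hr, zero_add,
    Nat.mod_eq_of_lt hd]

theorem mod_pow_succ_eq (b n k : ℕ) : k % b ^ (n + 1) = k % b ^ n + b ^ n * natDigit b k n := by
  rw [natDigit, pow_succ, Nat.mod_mul]

theorem mod_pow_eq_of_natDigit_eq {b n k l : ℕ} (h : ∀ j < n, natDigit b k j = natDigit b l j) :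
    k % b ^ n = l % b ^ n := by
  induction n with
  | zero => simp [Nat.mod_one]
  | succ n ih =>
    rw [mod_pow_succ_eq, mod_pow_succ_eq, ih fun j hj => h j (by omega), h n (by omega)]

theorem eq_of_natDigit_eq {b n k l : ℕ} (hk : k < b ^ n) (hl : l < b ^ n)
    (h : ∀ j < n, natDigit b k j = natDigit b l j) : k = l := by
  rw [← Nat.mod_eq_of_lt hk, ← Nat.mod_eq_of_lt hl, mod_pow_eq_of_natDigit_eq h]

theorem sum_range_mul {M : Type*} [AddCommMonoid M] (m b : ℕ) (g : ℕ → M) :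
    ∑ k ∈ Finset.range (m * b), g k = ∑ d ∈ Finset.range b, ∑ r ∈ Finset.range m, g (r + m * d) := by
  induction b with
  | zero => simp
  | succ b ih =>
    rw [Nat.mul_succ, Finset.sum_range_add, Finset.sum_range_succ, ih]
    simp [add_comm]

/-- Sums over `k < b ^ n` of products over the digits of `k` factorize. -/
theorem sum_prod_natDigit (b : ℕ) [NeZero b] (n : ℕ) (f : ℕ → ℕ → ℂ) :
    ∑ k ∈ Finset.range (b ^ n), ∏ j ∈ Finset.range n, f j (natDigit b k j) =
      ∏ j ∈ Finset.range n, ∑ d ∈ Finset.range b, f j d := by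
  have hb := NeZero.pos b
  induction n with
  | zero => simp
  | succ n ih =>
    rw [pow_succ, sum_range_mul, Finset.prod_range_succ, ← ih, Finset.mul_sum]
    refine Finset.sum_congr rfl fun d hd => ?_
    rw [Finset.sum_mul]
    refine Finset.sum_congr rfl fun r hr => ?_
    rw [Finset.prod_range_succ, natDigit_add_mul_self hb (Finset.mem_range.mp hr)
      (Finset.mem_range.mp hd)]
    congr 1
    refine Finset.prod_congr rfl fun j hj => ?_
    rw [natDigit_add_mul_of_lt hb _ _ (Finset.mem_range.mp hj)]

theorem wal_eq_prod {b : ℕ} (hb : 2 ≤ b) {k n : ℕ} (hk : k < b ^ n) (d : ℕ → Fin b) :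
    wal b k d = ∏ j ∈ Finset.range n, e (natDigit b k j * ((d j : ℕ) : ℝ) / b) := by
  have h0 : ∀ N, k < b ^ N → ∀ M, N ≤ M →
      ∑ l ∈ Finset.range M, natDigit b k l * (d l : ℕ) =
        ∑ l ∈ Finset.range N, natDigit b k l * (d l : ℕ) := fun N hN M hNM => by
    refine (Finset.sum_subset (Finset.range_mono hNM) fun j _ hj => ?_).symm
    rw [natDigit_eq_zero (by omega) hN (by simpa using hj), zero_mul]
  have h1 : ∑ l ∈ Finset.range k, natDigit b k l * (d l : ℕ) =
      ∑ l ∈ Finset.range n, natDigit b k l * (d l : ℕ) := by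
    rw [← h0 k (Nat.lt_pow_self (by omega)) _ (le_max_left k n),
      ← h0 n hk _ (le_max_right k n)]
  rw [wal, h1, ← e_sum, e]
  congr 1
  push_cast
  rw [mul_comm_div, ← Finset.sum_div]

theorem norm_wal {b : ℕ} (hb : 2 ≤ b) (k : ℕ) (d : ℕ → Fin b) : ‖wal b k d‖ = 1 := by
  rw [wal_eq_prod hb (Nat.lt_pow_self (n := k) (by omega)), norm_prod]
  simp [norm_e]

theorem wal_add {b : ℕ} [NeZero b] (hb : 2 ≤ b) (k : ℕ) (d d' : ℕ → Fin b) :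
    wal b k (d + d') = wal b k d * wal b k d' := by
  have hk : k < b ^ k := Nat.lt_pow_self (by omega)
  rw [wal_eq_prod hb hk, wal_eq_prod hb hk, wal_eq_prod hb hk, ← Finset.prod_mul_distrib]
  refine Finset.prod_congr rfl fun j _ => ?_
  rw [Pi.add_apply, Fin.val_add, e_mul_mod_div, ← e_add]
  congr 1
  push_cast
  ring

/-- Walsh functions are characters of modulus one on digit sequences, so inversion is conjugation.
-/
theorem wal_sub {b : ℕ} [NeZero b] (hb : 2 ≤ b) (k : ℕ) (d d' : ℕ → Fin b) :
    wal b k (d - d') = wal b k d * (starRingEnd ℂ) (wal b k d') := by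
  have h := wal_add hb k (d - d') d'
  have h2 : (d - d') + d' = d := by ext j; simp
  rw [h2] at h
  rw [h, mul_assoc, Complex.mul_conj, Complex.normSq_eq_norm_sq, norm_wal hb]
  simp

/-! ### Walsh coefficients of truncated exponentials -/

/-- The coefficient of `d ↦ e(κ d / b)` in the expansion of the function `d ↦ e(h d / b ^ (j + 1))`
on the digits modulo `b`. -/
def digitCoeff (b j : ℕ) (h : ℤ) (κ : ℕ) : ℂ :=
  (b : ℂ)⁻¹ * ∑ d ∈ Finset.range b, e (d * ((h / b ^ j - κ) / b))

/-- The `k`-th Walsh coefficient of `x ↦ e(h x)` evaluated at `x` rounded down to `n` digits. -/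
def walshCoeff (b n : ℕ) (h : ℤ) (k : ℕ) : ℂ :=
  ∏ j ∈ Finset.range n, digitCoeff b j h (natDigit b k j)

theorem sum_digitCoeff_mul (b j : ℕ) [NeZero b] (h : ℤ) {x : ℕ} (hx : x < b) :
    ∑ κ ∈ Finset.range b, digitCoeff b j h κ * e (κ * (x : ℝ) / b) =
      e (h * (x * ((b : ℝ) ^ (j + 1))⁻¹)) := by
  have hb : (b : ℝ) ≠ 0 := by exact_mod_cast NeZero.ne b
  have hb' : (b : ℂ) ≠ 0 := by exact_mod_cast NeZero.ne b
  have h1 : ∀ κ ∈ Finset.range b, digitCoeff b j h κ * e (κ * (x : ℝ) / b) =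
      (b : ℂ)⁻¹ * ∑ d ∈ Finset.range b, e (h * (d * ((b : ℝ) ^ (j + 1))⁻¹)) *
        e (κ * (((x - d : ℤ) : ℝ) / b)) := fun κ _ => by
    rw [digitCoeff, mul_assoc, Finset.sum_mul]
    congr 1
    refine Finset.sum_congr rfl fun d _ => ?_
    rw [← e_add, ← e_add]
    congr 1
    push_cast
    field_simp
    ring
  rw [Finset.sum_congr rfl h1, ← Finset.mul_sum, Finset.sum_comm]
  have h2 : ∀ d ∈ Finset.range b, ∑ κ ∈ Finset.range b, e (h * (d * ((b : ℝ) ^ (j + 1))⁻¹)) *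
        e (κ * (((x - d : ℤ) : ℝ) / b)) =
      if d = x then (b : ℂ) * e (h * (x * ((b : ℝ) ^ (j + 1))⁻¹)) else 0 := fun d hd => by
    rw [← Finset.mul_sum, sum_e_mul_div]
    have hd := Finset.mem_range.mp hd
    by_cases hdx : d = x
    · simp [hdx, mul_comm]
    · have : ¬ (b : ℤ) ∣ (x - d : ℤ) := by
        intro hdvd
        have := Int.eq_zero_of_abs_lt_dvd hdvd (by rw [abs_lt]; omega)
        omega
      rw [if_neg this, if_neg hdx, mul_zero]
  rw [Finset.sum_congr rfl h2, Finset.sum_ite_eq' _ _ _, if_pos (Finset.mem_range.mpr hx),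
    inv_mul_cancel_left₀ hb']

/-- The exponential factors over the digits. Expanding each factor in the characters modulo `b` and
multiplying out, each choice of one frequency per digit is the digit string of a unique `k < b ^ n`.
-/
theorem e_trunc_eq_sum {b : ℕ} [NeZero b] (hb : 2 ≤ b) (n : ℕ) (h : ℤ) (d : ℕ → Fin b) :
    e (h * ∑ j ∈ Finset.range n, Real.ofDigitsTerm d j) =
      ∑ k ∈ Finset.range (b ^ n), walshCoeff b n h k * wal b k d := by
  let f : ℕ → ℕ → ℂ := fun j κ => digitCoeff b j h κ * e (κ * ((d j : ℕ) : ℝ) / b)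
  have h1 : ∀ k ∈ Finset.range (b ^ n), walshCoeff b n h k * wal b k d =
      ∏ j ∈ Finset.range n, f j (natDigit b k j) := fun k hk => by
    rw [wal_eq_prod hb (Finset.mem_range.mp hk), walshCoeff, Finset.prod_mul_distrib]
  rw [Finset.sum_congr rfl h1, sum_prod_natDigit, Finset.mul_sum, e_sum]
  refine Finset.prod_congr rfl fun j _ => ?_
  simp only [f]
  rw [sum_digitCoeff_mul _ _ _ (d j).2, Real.ofDigitsTerm]

/-- A digit sequence whose first `n` entries are the digits of `q / b ^ n`. -/
def gridDigits (b n : ℕ) [NeZero b] (q : ℕ) : ℕ → Fin b := fun j => Fin.ofNat b (q / b ^ (n - 1 - j))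

theorem sum_wal_gridDigits {b : ℕ} [NeZero b] (hb : 2 ≤ b) {n k l : ℕ} (hk : k < b ^ n)
    (hl : l < b ^ n) :
    ∑ q ∈ Finset.range (b ^ n), wal b k (gridDigits b n q) *
        (starRingEnd ℂ) (wal b l (gridDigits b n q)) = if k = l then (b : ℂ) ^ n else 0 := by
  let f : ℕ → ℕ → ℂ := fun j d =>
    e (d * (((natDigit b k (n - 1 - j) : ℤ) - (natDigit b l (n - 1 - j) : ℤ) : ℤ) / b))
  have h1 : ∀ q ∈ Finset.range (b ^ n), wal b k (gridDigits b n q) *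
        (starRingEnd ℂ) (wal b l (gridDigits b n q)) =
      ∏ j ∈ Finset.range n, f j (natDigit b q j) := fun q _ => by
    -- Entry `j` of the expansion of `q / b ^ n` is digit `n - 1 - j` of `q`; reflecting the product
    -- indexes it by the digits of `q`.
    rw [wal_eq_prod hb hk, wal_eq_prod hb hl, map_prod, ← Finset.prod_mul_distrib,
      ← Finset.prod_range_reflect]
    refine Finset.prod_congr rfl fun j hj => ?_
    have hj := Finset.mem_range.mp hj
    have hg : ((gridDigits b n q (n - 1 - j) : Fin b) : ℕ) = natDigit b q j := by
      rw [gridDigits, Fin.val_ofNat, natDigit, show n - 1 - (n - 1 - j) = j by omega]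
    rw [hg, conj_e, ← e_add]
    congr 1
    push_cast
    ring
  rw [Finset.sum_congr rfl h1, sum_prod_natDigit]
  simp only [f, sum_e_mul_div]
  split_ifs with hkl
  · subst hkl; simp
  · have : ∃ j < n, natDigit b k j ≠ natDigit b l j := by
      by_contra! hcon
      exact hkl (eq_of_natDigit_eq hk hl hcon)
    obtain ⟨j, hj, hne⟩ := this
    refine Finset.prod_eq_zero (i := n - 1 - j) (Finset.mem_range.mpr (by omega)) ?_
    rw [show n - 1 - (n - 1 - j) = j by omega, if_neg]
    intro hdvd
    have h2 := natDigit_lt b k j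
    have h3 := natDigit_lt b l j
    have := Int.eq_zero_of_abs_lt_dvd hdvd (by rw [abs_lt]; omega)
    omega

/-- Parseval's identity for the Walsh functions on the grid with spacing `b ^ (-n)`. -/
theorem sum_norm_sq_walsh_gridDigits {b : ℕ} [NeZero b] (hb : 2 ≤ b) (n : ℕ) (v : ℕ → ℂ) :
    ∑ q ∈ Finset.range (b ^ n), ‖∑ k ∈ Finset.range (b ^ n), v k * wal b k (gridDigits b n q)‖ ^ 2 =
      (b : ℝ) ^ n * ∑ k ∈ Finset.range (b ^ n), ‖v k‖ ^ 2 := by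
  have key : ∑ q ∈ Finset.range (b ^ n),
      ((∑ k ∈ Finset.range (b ^ n), v k * wal b k (gridDigits b n q)) *
        (starRingEnd ℂ) (∑ k ∈ Finset.range (b ^ n), v k * wal b k (gridDigits b n q))) =
      (b : ℂ) ^ n * ∑ k ∈ Finset.range (b ^ n), v k * (starRingEnd ℂ) (v k) := by
    simp only [map_sum, map_mul, Finset.sum_mul_sum]
    rw [Finset.sum_comm, Finset.mul_sum]
    refine Finset.sum_congr rfl fun k hk => ?_
    rw [Finset.sum_comm]
    have h1 : ∀ l ∈ Finset.range (b ^ n), ∑ q ∈ Finset.range (b ^ n),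
        v k * wal b k (gridDigits b n q) * ((starRingEnd ℂ) (v l) *
          (starRingEnd ℂ) (wal b l (gridDigits b n q))) =
        if l = k then (b : ℂ) ^ n * (v k * (starRingEnd ℂ) (v k)) else 0 := fun l hl => by
      have h2 := sum_wal_gridDigits hb (Finset.mem_range.mp hk) (Finset.mem_range.mp hl)
      have h3 : ∀ q, v k * wal b k (gridDigits b n q) * ((starRingEnd ℂ) (v l) *
          (starRingEnd ℂ) (wal b l (gridDigits b n q))) = (v k * (starRingEnd ℂ) (v l)) *
          (wal b k (gridDigits b n q) * (starRingEnd ℂ) (wal b l (gridDigits b n q))) :=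
        fun q => by ring
      simp only [h3]
      rw [← Finset.mul_sum, h2]
      by_cases hkl : l = k
      · subst hkl; simp [mul_comm]
      · rw [if_neg hkl, if_neg (Ne.symm hkl), mul_zero]
    rw [Finset.sum_congr rfl h1, Finset.sum_ite_eq' _ _ _, if_pos hk]
  simp only [Complex.mul_conj, Complex.normSq_eq_norm_sq] at key
  exact_mod_cast key

/-! ### Bounds for the coefficients -/

theorem norm_digitCoeff_le_one (b j : ℕ) [NeZero b] (h : ℤ) (κ : ℕ) : ‖digitCoeff b j h κ‖ ≤ 1 := by
  have hb : (b : ℝ) ≠ 0 := by exact_mod_cast NeZero.ne b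
  rw [digitCoeff, norm_mul, norm_inv, Complex.norm_natCast]
  have : ‖∑ d ∈ Finset.range b, e (d * ((h / b ^ j - κ) / b))‖ ≤ b := by
    refine (norm_sum_le _ _).trans ?_
    simp [norm_e]
  calc _ ≤ (b : ℝ)⁻¹ * b := by gcongr
    _ = 1 := inv_mul_cancel₀ hb

theorem norm_walshCoeff_le_one (b n : ℕ) [NeZero b] (h : ℤ) (k : ℕ) : ‖walshCoeff b n h k‖ ≤ 1 := by
  rw [walshCoeff, norm_prod]
  exact Finset.prod_le_one (fun _ _ => norm_nonneg _) fun _ _ => norm_digitCoeff_le_one ..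

/-- For `κ ≠ 0` the character `d ↦ e(-κ d / b)` sums to zero, so `1` may be subtracted from the
other factor, which is then small by `|e(t) - 1| ≤ 2π|t|`. -/
theorem norm_digitCoeff_le (b j : ℕ) [NeZero b] (h : ℤ) {κ : ℕ} (h0 : κ ≠ 0) (hκ : κ < b) :
    ‖digitCoeff b j h κ‖ ≤ 2 * Real.pi * |(h : ℝ)| / b ^ j := by
  have hb : (0 : ℝ) < b := by exact_mod_cast NeZero.pos b
  have h1 : ∑ d ∈ Finset.range b, e (d * ((h / b ^ j - κ) / b)) =
      ∑ d ∈ Finset.range b, (e (d * (h / b ^ j / b)) - 1) * e (d * ((-κ : ℤ) / b)) := by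
    simp only [sub_mul, one_mul, Finset.sum_sub_distrib, sum_e_mul_div]
    rw [if_neg, sub_zero]
    · refine Finset.sum_congr rfl fun d _ => ?_
      rw [← e_add]
      congr 1
      push_cast
      ring
    · rw [Int.dvd_neg, Int.natCast_dvd_natCast]
      exact Nat.not_dvd_of_pos_of_lt (by omega) hκ
  rw [digitCoeff, norm_mul, norm_inv, Complex.norm_natCast, h1]
  have h2 : ‖∑ d ∈ Finset.range b, (e (d * (h / b ^ j / b)) - 1) * e (d * ((-κ : ℤ) / b))‖ ≤
      ∑ d ∈ Finset.range b, 2 * Real.pi * |(h : ℝ)| / b ^ j := by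
    refine norm_sum_le_of_le _ fun d hd => ?_
    rw [norm_mul, norm_e, mul_one]
    refine (norm_e_sub_one_le _).trans ?_
    have hd' : (d : ℝ) / b ≤ 1 := by
      rw [div_le_one hb]; exact_mod_cast (Finset.mem_range.mp hd).le
    have h3 : |(d : ℝ) * (h / b ^ j / b)| = (d / b) * (|(h : ℝ)| / b ^ j) := by
      rw [abs_mul, abs_div, abs_div, abs_of_pos hb, abs_of_pos (pow_pos hb j),
        abs_of_nonneg (Nat.cast_nonneg d)]
      ring
    rw [h3]
    calc 2 * Real.pi * (d / b * (|(h : ℝ)| / b ^ j)) ≤ 2 * Real.pi * (1 * (|(h : ℝ)| / b ^ j)) := by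
          gcongr
      _ = _ := by ring
  calc _ ≤ (b : ℝ)⁻¹ * ∑ d ∈ Finset.range b, 2 * Real.pi * |(h : ℝ)| / b ^ j := by gcongr
    _ = _ := by rw [Finset.sum_const, Finset.card_range, nsmul_eq_mul]; field_simp

theorem digitCoeff_eq_zero (b j : ℕ) [NeZero b] {h : ℤ} (m : ℤ) (hm : h = b ^ j * m)
    (hndvd : ¬ (b : ℤ) ∣ m) : digitCoeff b j h 0 = 0 := by
  have hb : (b : ℝ) ≠ 0 := by exact_mod_cast NeZero.ne b
  have : ((h : ℝ) / b ^ j - (0 : ℕ)) = m := by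
    rw [hm]; push_cast; field_simp; simp
  rw [digitCoeff, this, sum_e_mul_div, if_neg hndvd, mul_zero]

/-- The product of the zeroth digit coefficients is supported on the multiples of `b ^ m`. -/
theorem pow_dvd_of_walshCoeff_ne_zero {b m k : ℕ} [NeZero b] {h : ℤ}
    (hk : ∀ j < m, natDigit b k j = 0) (hc : walshCoeff b m h k ≠ 0) : (b : ℤ) ^ m ∣ h := by
  induction m with
  | zero => simp
  | succ m ih =>
    rw [walshCoeff, Finset.prod_range_succ] at hc
    obtain ⟨q, hq⟩ := ih (fun j hj => hk j (by omega)) (left_ne_zero_of_mul hc)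
    have h2 := right_ne_zero_of_mul hc
    rw [hk m (by omega)] at h2
    have h3 : (b : ℤ) ∣ q := by
      by_contra hcon
      exact h2 (digitCoeff_eq_zero b m q hq hcon)
    rw [pow_succ, hq]
    exact mul_dvd_mul_left _ h3

/-- Adding a multiple of `b ^ m` with `m > j` changes every phase `d h / b ^ (j + 1)` by an integer.
-/
theorem digitCoeff_add_mul {b j m : ℕ} [NeZero b] (hj : j < m) (h t : ℤ) (κ : ℕ) :
    digitCoeff b j (h + b ^ m * t) κ = digitCoeff b j h κ := by
  have hb : (b : ℝ) ≠ 0 := by exact_mod_cast NeZero.ne b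
  obtain ⟨i, rfl⟩ := Nat.exists_eq_add_of_lt hj
  rw [digitCoeff, digitCoeff]
  congr 1
  refine Finset.sum_congr rfl fun d _ => ?_
  refine e_eq_of_sub_intCast (d * (b ^ i * t)) ?_
  push_cast
  rw [pow_add, pow_add]
  field_simp
  ring

theorem walshCoeff_add_mul {b m : ℕ} [NeZero b] (h t : ℤ) (k : ℕ) :
    walshCoeff b m (h + b ^ m * t) k = walshCoeff b m h k :=
  Finset.prod_congr rfl fun _ hj => digitCoeff_add_mul (Finset.mem_range.mp hj) _ _ _

/-- Varying `t` runs through a full set of frequencies modulo `b`: after expanding the square, the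
sum over `t` leaves only the `b` diagonal pairs `d = d'`, each contributing `b`, against the
prefactor `b⁻²`. -/
theorem sum_norm_sq_digitCoeff (b j : ℕ) [NeZero b] (r : ℤ) (κ : ℕ) :
    ∑ t ∈ Finset.range b, ‖digitCoeff b j (r + b ^ j * t) κ‖ ^ 2 = 1 := by
  have hb : (b : ℝ) ≠ 0 := by exact_mod_cast NeZero.ne b
  have hb' : (b : ℂ) ≠ 0 := by exact_mod_cast NeZero.ne b
  have key : ∑ t ∈ Finset.range b, digitCoeff b j (r + b ^ j * t) κ *
      (starRingEnd ℂ) (digitCoeff b j (r + b ^ j * t) κ) = 1 := by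
    have h1 : ∀ t ∈ Finset.range b, digitCoeff b j (r + b ^ j * t) κ *
        (starRingEnd ℂ) (digitCoeff b j (r + b ^ j * t) κ) =
        (b : ℂ)⁻¹ * (b : ℂ)⁻¹ * ∑ d ∈ Finset.range b, ∑ d' ∈ Finset.range b,
          e ((d - d') * ((r / b ^ j - κ) / b)) * e (t * (((d - d' : ℤ) : ℝ) / b)) := fun t _ => by
      simp only [digitCoeff, map_mul, map_inv₀, map_sum, Complex.conj_natCast, conj_e]
      rw [mul_mul_mul_comm, Finset.sum_mul_sum]
      congr 1
      refine Finset.sum_congr rfl fun d _ => Finset.sum_congr rfl fun d' _ => ?_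
      rw [← e_add, ← e_add]
      congr 1
      push_cast
      field_simp
      ring
    rw [Finset.sum_congr rfl h1, ← Finset.mul_sum, Finset.sum_comm]
    have h2 : ∀ d ∈ Finset.range b, ∑ t ∈ Finset.range b, ∑ d' ∈ Finset.range b,
        e ((d - d') * ((r / b ^ j - κ) / b)) * e (t * (((d - d' : ℤ) : ℝ) / b)) = (b : ℂ) :=
      fun d hd => by
      rw [Finset.sum_comm]
      have h3 : ∀ d' ∈ Finset.range b, ∑ t ∈ Finset.range b,
          e ((d - d') * ((r / b ^ j - κ) / b)) * e (t * (((d - d' : ℤ) : ℝ) / b)) =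
          if d' = d then (b : ℂ) else 0 := fun d' hd' => by
        rw [← Finset.mul_sum, sum_e_mul_div]
        have hd := Finset.mem_range.mp hd
        have hd' := Finset.mem_range.mp hd'
        by_cases hdd : d' = d
        · subst hdd; simp [e_zero]
        · have : ¬ (b : ℤ) ∣ (d - d' : ℤ) := by
            intro hdvd
            have := Int.eq_zero_of_abs_lt_dvd hdvd (by rw [abs_lt]; omega)
            omega
          rw [if_neg this, if_neg hdd, mul_zero]
      rw [Finset.sum_congr rfl h3, Finset.sum_ite_eq' _ _ _, if_pos hd]
    rw [Finset.sum_congr rfl h2, Finset.sum_const, Finset.card_range, nsmul_eq_mul]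
    field_simp
  simp only [Complex.mul_conj, Complex.normSq_eq_norm_sq] at key
  exact_mod_cast key

/-- The leading digit of a residue modulo `b ^ (m + 1)` affects only the last factor, so the sum
over that digit splits off and equals one. -/
theorem sum_norm_sq_walshCoeff (b m k : ℕ) [NeZero b] :
    ∑ r ∈ Finset.range (b ^ m), ‖walshCoeff b m r k‖ ^ 2 = 1 := by
  induction m with
  | zero => simp [walshCoeff]
  | succ m ih =>
    rw [pow_succ, sum_range_mul, Finset.sum_comm, ← ih]
    refine Finset.sum_congr rfl fun r _ => ?_
    have h1 : ∀ t ∈ Finset.range b, ‖walshCoeff b (m + 1) ((r + b ^ m * t : ℕ) : ℤ) k‖ ^ 2 =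
        ‖walshCoeff b m r k‖ ^ 2 * ‖digitCoeff b m (r + b ^ m * t) (natDigit b k m)‖ ^ 2 :=
      fun t _ => by
      have h2 := walshCoeff_add_mul (b := b) (m := m) r t k
      rw [walshCoeff] at h2 ⊢
      push_cast
      rw [Finset.prod_range_succ, h2, norm_mul, mul_pow]
    rw [Finset.sum_congr rfl h1, ← Finset.mul_sum, sum_norm_sq_digitCoeff, mul_one]

/-! ### Positions of nonzero digits -/

/-- The decreasing list of the positions below `N` of the nonzero digits of `k`. -/
def digitSupport (b k N : ℕ) : List ℕ := (List.range N).reverse.filter fun a => natDigit b k a ≠ 0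

theorem digitSupport_succ (b k N : ℕ) : digitSupport b k (N + 1) =
    if natDigit b k N = 0 then digitSupport b k N else N :: digitSupport b k N := by
  rw [digitSupport, List.range_succ, List.reverse_append]
  simp only [List.reverse_singleton, List.singleton_append, List.filter_cons, digitSupport]
  split_ifs <;> simp_all

theorem digitSupport_congr {b k l N : ℕ}
    (h : ∀ j < N, natDigit b k j = 0 ↔ natDigit b l j = 0) :
    digitSupport b k N = digitSupport b l N := by
  induction N with
  | zero => rfl
  | succ N ih =>
    rw [digitSupport_succ, digitSupport_succ, ih fun j hj => h j (by omega)]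
    simp only [h N (by omega)]

theorem digitSupport_of_le {b k N M : ℕ} (hb : 0 < b) (hk : k < b ^ N) (h : N ≤ M) :
    digitSupport b k M = digitSupport b k N := by
  induction M, h using Nat.le_induction with
  | base => rfl
  | succ M hM ih => rw [digitSupport_succ, if_pos (natDigit_eq_zero hb hk hM), ih]

/-- Replaces the search range `k` in `positions` by any `N` with `k < b ^ N`, which makes induction
on the number of digits possible. -/
theorem positions_eq_map_digitSupport {b k N : ℕ} (hb : 2 ≤ b) (hk : k < b ^ N) :
    positions b k = (digitSupport b k N).map (· + 1) := by
  have h1 : positions b k = (digitSupport b k k).map (· + 1) := rfl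
  rw [h1, ← digitSupport_of_le (by omega) (Nat.lt_pow_self (by omega)) (le_max_left k N),
    digitSupport_of_le (by omega) hk (le_max_right k N)]

theorem positions_congr {b k l N : ℕ} (hb : 2 ≤ b) (hk : k < b ^ N) (hl : l < b ^ N)
    (h : ∀ j < N, natDigit b k j = 0 ↔ natDigit b l j = 0) : positions b k = positions b l := by
  rw [positions_eq_map_digitSupport hb hk, positions_eq_map_digitSupport hb hl,
    digitSupport_congr h]

theorem muRing_congr {b k l N : ℕ} (hb : 2 ≤ b) (α : ℕ) (hk : k < b ^ N) (hl : l < b ^ N)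
    (h : ∀ j < N, natDigit b k j = 0 ↔ natDigit b l j = 0) : muRing b α k = muRing b α l := by
  rw [muRing, muRing, mu, mu, positions_congr hb hk hl h]

theorem mem_digitSupport {b k N j : ℕ} : j ∈ digitSupport b k N ↔ j < N ∧ natDigit b k j ≠ 0 := by
  simp [digitSupport]

theorem pairwise_digitSupport (b k N : ℕ) : (digitSupport b k N).Pairwise (· > ·) := by
  refine List.Pairwise.filter _ ?_
  rw [List.pairwise_reverse]
  exact List.pairwise_lt_range

/-- The weight `μ̊_α(k)` in terms of the set `T` of the `min(α, #k)` highest positions of nonzero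
digits and of its least element `m`. -/
theorem exists_muRing_eq {b α n k : ℕ} (hb : 2 ≤ b) (hα : 1 ≤ α) (hk0 : k ≠ 0) (hk : k < b ^ n) :
    ∃ T : Finset ℕ, ∃ m ∈ T, (∀ a ∈ T, m ≤ a ∧ a < n ∧ natDigit b k a ≠ 0) ∧ T.card ≤ α ∧
      (T.card < α → ∀ j < m, natDigit b k j = 0) ∧
      muRing b α k = ∑ a ∈ T, (a + 1) + (α - T.card) * (m + 1) := by
  set P := digitSupport b k n with hP
  have hne : P ≠ [] := by
    intro h0
    refine hk0 (eq_of_natDigit_eq hk (Nat.pow_pos (by omega)) fun j hj => ?_)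
    have : j ∉ P := by simp [h0]
    rw [hP, mem_digitSupport] at this
    have h00 : natDigit b 0 j = 0 := by simp [natDigit]
    rw [h00]
    tauto
  have hpw : P.Pairwise (· > ·) := pairwise_digitSupport b k n
  set Q := P.take α with hQ
  have hQne : Q ≠ [] := by
    rw [hQ, Ne, List.take_eq_nil_iff]; push Not; exact ⟨by omega, hne⟩
  have hQpw : Q.Pairwise (· > ·) := hpw.sublist (List.take_sublist _ _)
  have hQnd : Q.Nodup := hQpw.imp fun h => (ne_of_gt h)
  have hcard : Q.toFinset.card = min α P.length := by
    rw [List.toFinset_card_of_nodup hQnd, hQ, List.length_take]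
  have hlast : ∀ a ∈ Q, Q.getLast hQne ≤ a := by
    intro a ha
    rw [← List.dropLast_append_getLast hQne] at ha hQpw
    rw [List.pairwise_append] at hQpw
    rcases List.mem_append.mp ha with h | h
    · exact (hQpw.2.2 a h _ (List.mem_singleton_self _)).le
    · rw [List.mem_singleton.mp h]
  have hmem : ∀ a ∈ Q, a < n ∧ natDigit b k a ≠ 0 := fun a ha =>
    mem_digitSupport.mp (List.mem_of_mem_take ha)
  refine ⟨Q.toFinset, Q.getLast hQne, by simp, fun a ha => ⟨hlast a (by simpa using ha),
    hmem a (by simpa using ha)⟩, by omega, fun hlt j hj => ?_, ?_⟩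
  · by_contra hcon
    -- Fewer than `α` elements were taken, so the list was exhausted and its last entry is the
    -- lowest nonzero position.
    have hPQ : Q = P := List.take_of_length_le (by omega)
    have hm : Q.getLast hQne < n := (hmem _ (List.getLast_mem hQne)).1
    have : j ∈ P := mem_digitSupport.mpr ⟨by omega, hcon⟩
    have := hlast j (hPQ ▸ this)
    omega
  · rw [muRing, mu, positions_eq_map_digitSupport hb hk, ← hP, ← List.map_take, ← hQ,
      List.sum_toFinset _ hQnd, List.length_map, hcard]
    congr 1
    rcases le_or_gt α P.length with h | h
    · rw [Nat.sub_eq_zero_of_le h, Nat.sub_eq_zero_of_le (by omega), zero_mul, zero_mul]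
    · have hPQ : Q = P := List.take_of_length_le (by omega)
      rw [min_eq_right h.le]
      congr 1
      simp only [hPQ]
      rw [List.getLastD_eq_getLast?, List.getLast?_map, List.getLast?_eq_getLast_of_ne_nil hne]
      simp

/-! ### Summability of the weights -/

theorem positions_add_mul {b n r d : ℕ} (hb : 2 ≤ b) (hr : r < b ^ n) (hd0 : d ≠ 0) (hd : d < b) :
    positions b (r + b ^ n * d) = (n + 1) :: positions b r := by
  have hk : r + b ^ n * d < b ^ (n + 1) := by
    calc r + b ^ n * d < b ^ n + b ^ n * d := by omega
      _ = b ^ n * (d + 1) := by ring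
      _ ≤ b ^ n * b := Nat.mul_le_mul_left _ (by omega)
      _ = _ := (pow_succ b n).symm
  rw [positions_eq_map_digitSupport hb hk, positions_eq_map_digitSupport hb hr,
    digitSupport_succ, natDigit_add_mul_self (by omega) hr hd, if_neg hd0, List.map_cons,
    digitSupport_congr (l := r)]
  intro j hj
  rw [natDigit_add_mul_of_lt (by omega) _ _ hj]

/-- For `α ≥ 2` the weight contains at least the two highest positions; the default `0` covers the
case where only one digit is nonzero. -/
theorem add_headD_le_muRing {b n r d α : ℕ} (hb : 2 ≤ b) (hα : 2 ≤ α) (hr : r < b ^ n) (hd0 : d ≠ 0)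
    (hd : d < b) : (n + 1) + (positions b r).headD 0 ≤ muRing b α (r + b ^ n * d) := by
  rw [muRing, mu, positions_add_mul hb hr hd0 hd]
  obtain ⟨β, rfl⟩ := Nat.exists_eq_add_of_le' hα
  cases positions b r with
  | nil => simp
  | cons p l => simp; omega

/-- The `(b - 1) b ^ n` integers with leading position `n` contribute `b ^ (-(n + 1))` each, hence
at most one per block; `k = 0` accounts for the extra one. -/
theorem sum_inv_pow_headD_le {b : ℕ} (hb : 2 ≤ b) (n : ℕ) :
    ∑ k ∈ Finset.range (b ^ n), ((b : ℝ) ^ (positions b k).headD 0)⁻¹ ≤ n + 1 := by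
  have hbR : (0 : ℝ) < b := by exact_mod_cast (by omega : 0 < b)
  induction n with
  | zero => simp [positions]
  | succ n ih =>
    obtain ⟨c, rfl⟩ := Nat.exists_eq_add_of_le' hb
    rw [pow_succ, sum_range_mul, Finset.sum_range_succ']
    have h1 : ∑ d ∈ Finset.range (c + 1), ∑ r ∈ Finset.range ((c + 2) ^ n),
        (((c + 2 : ℕ) : ℝ) ^ (positions (c + 2) (r + (c + 2) ^ n * (d + 1))).headD 0)⁻¹ ≤ 1 := by
      have h2 : ∀ d ∈ Finset.range (c + 1), ∑ r ∈ Finset.range ((c + 2) ^ n),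
          (((c + 2 : ℕ) : ℝ) ^ (positions (c + 2) (r + (c + 2) ^ n * (d + 1))).headD 0)⁻¹ =
          (((c + 2 : ℕ) : ℝ))⁻¹ := fun d hd => by
        have h3 : ∀ r ∈ Finset.range ((c + 2) ^ n),
            (((c + 2 : ℕ) : ℝ) ^ (positions (c + 2) (r + (c + 2) ^ n * (d + 1))).headD 0)⁻¹ =
            (((c + 2 : ℕ) : ℝ) ^ (n + 1))⁻¹ := fun r hr => by
          rw [positions_add_mul hb (Finset.mem_range.mp hr) (by omega)
            (by have := Finset.mem_range.mp hd; omega), List.headD_cons]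
        rw [Finset.sum_congr rfl h3, Finset.sum_const, Finset.card_range, nsmul_eq_mul, pow_succ,
          mul_inv, ← mul_assoc]
        push_cast
        rw [mul_inv_cancel₀ (by positivity), one_mul]
      rw [Finset.sum_congr rfl h2, Finset.sum_const, Finset.card_range, nsmul_eq_mul,
        mul_inv_le_iff₀ hbR]
      push_cast; linarith
    simp only [mul_zero, add_zero]
    push_cast at h1 ih ⊢
    linarith

/-- The integers with leading position `n` contribute at most `(n + 1) / b ^ n ≤ (n + 1) / 2 ^ n`.
The right-hand side is the closed form of `1 + ∑_{i < n} (i + 1) / 2 ^ i`. -/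
theorem sum_rRingRing2_le {b α : ℕ} (hb : 2 ≤ b) (hα : 2 ≤ α) (n : ℕ) :
    ∑ k ∈ Finset.range (b ^ n), rRingRing2 b α k ≤ 5 - (2 * n + 4) / 2 ^ n := by
  have hbR : (0 : ℝ) < b := by exact_mod_cast (by omega : 0 < b)
  induction n with
  | zero => simp [rRingRing2, muRing, mu, positions]; norm_num
  | succ n ih =>
    obtain ⟨c, rfl⟩ := Nat.exists_eq_add_of_le' hb
    rw [pow_succ, sum_range_mul, Finset.sum_range_succ']
    have h1 : ∑ d ∈ Finset.range (c + 1), ∑ r ∈ Finset.range ((c + 2) ^ n),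
        rRingRing2 (c + 2) α (r + (c + 2) ^ n * (d + 1)) ≤ (n + 1) / 2 ^ n := by
      have h2 : ∀ d ∈ Finset.range (c + 1), ∑ r ∈ Finset.range ((c + 2) ^ n),
          rRingRing2 (c + 2) α (r + (c + 2) ^ n * (d + 1)) ≤
          (((c + 2 : ℕ) : ℝ) ^ (n + 1))⁻¹ * (n + 1) := fun d hd => by
        refine le_trans ?_ (mul_le_mul_of_nonneg_left (sum_inv_pow_headD_le hb n) (by positivity))
        rw [Finset.mul_sum]
        refine Finset.sum_le_sum fun r hr => ?_
        rw [rRingRing2, ← mul_inv, ← pow_add]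
        gcongr
        · push_cast; linarith [(Nat.cast_nonneg c : (0 : ℝ) ≤ c)]
        · exact add_headD_le_muRing hb hα (Finset.mem_range.mp hr) (by omega)
            (by have := Finset.mem_range.mp hd; omega)
      refine (Finset.sum_le_sum h2).trans ?_
      rw [Finset.sum_const, Finset.card_range, nsmul_eq_mul]
      have h4 : ((c + 1 : ℕ) : ℝ) * ((((c + 2 : ℕ) : ℝ) ^ (n + 1))⁻¹ * (n + 1)) ≤
          ((c + 2 : ℕ) : ℝ) * ((((c + 2 : ℕ) : ℝ) ^ (n + 1))⁻¹ * (n + 1)) := by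
        gcongr; omega
      have h5 : ((c + 2 : ℕ) : ℝ) * ((((c + 2 : ℕ) : ℝ) ^ (n + 1))⁻¹ * (n + 1)) =
          (n + 1) / ((c + 2 : ℕ) : ℝ) ^ n := by
        rw [pow_succ]; field_simp
      have h6 : ((n : ℝ) + 1) / ((c + 2 : ℕ) : ℝ) ^ n ≤ (n + 1) / 2 ^ n := by
        gcongr; push_cast; linarith [(Nat.cast_nonneg c : (0 : ℝ) ≤ c)]
      linarith
    simp only [mul_zero, add_zero]
    have h7 : (5 : ℝ) - (2 * ((n + 1 : ℕ) : ℝ) + 4) / 2 ^ (n + 1) =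
        (5 - (2 * n + 4) / 2 ^ n) + (n + 1) / 2 ^ n := by
      rw [pow_succ]; push_cast; field_simp; ring
    rw [h7]
    linarith

theorem rRingRing2_pos {b : ℕ} (hb : 2 ≤ b) (α k : ℕ) : 0 < rRingRing2 b α k := by
  have hbR : (0 : ℝ) < b := by exact_mod_cast (by omega : 0 < b)
  rw [rRingRing2]; positivity

theorem rRing2_eq_sq (b α k : ℕ) : rRing2 b α k = rRingRing2 b α k ^ 2 := by
  rw [rRing2, rRingRing2, inv_pow, ← pow_mul, mul_comm]

theorem rRingRing2_le_one {b : ℕ} (hb : 2 ≤ b) (α k : ℕ) : rRingRing2 b α k ≤ 1 := by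
  have hbR : (1 : ℝ) ≤ b := by exact_mod_cast (by omega : 1 ≤ b)
  rw [rRingRing2]; exact inv_le_one_of_one_le₀ (one_le_pow₀ hbR)

theorem rRing2_le_rRingRing2 {b : ℕ} (hb : 2 ≤ b) (α k : ℕ) : rRing2 b α k ≤ rRingRing2 b α k := by
  rw [rRing2_eq_sq, sq]
  exact mul_le_of_le_one_left (rRingRing2_pos hb α k).le (rRingRing2_le_one hb α k)

theorem sum_range_pow_rRingRing2_le {b α : ℕ} (hb : 2 ≤ b) (hα : 2 ≤ α) (n : ℕ) :
    ∑ k ∈ Finset.range (b ^ n), rRingRing2 b α k ≤ 5 := by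
  refine (sum_rRingRing2_le hb hα n).trans ?_
  rw [sub_le_self_iff]
  positivity

theorem summable_rRingRing2 {b α : ℕ} (hb : 2 ≤ b) (hα : 2 ≤ α) : Summable (rRingRing2 b α) := by
  refine summable_of_sum_range_le (c := 5) (fun k => (rRingRing2_pos hb α k).le) fun n => ?_
  refine (Finset.sum_le_sum_of_subset_of_nonneg
    (Finset.range_mono (Nat.lt_pow_self (n := n) (by omega : 1 < b)).le)
    fun k _ _ => (rRingRing2_pos hb α k).le).trans (sum_range_pow_rRingRing2_le hb hα n)

theorem summable_rRing2 {b α : ℕ} (hb : 2 ≤ b) (hα : 2 ≤ α) : Summable (rRing2 b α) :=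
  (summable_rRingRing2 hb hα).of_nonneg_of_le
    (fun k => by rw [rRing2_eq_sq]; positivity) (rRing2_le_rRingRing2 hb α)

/-! ### Decay of the Walsh coefficients -/

theorem norm_walshCoeff_le {b n m : ℕ} [NeZero b] (h : ℤ) (k : ℕ) {T : Finset ℕ}
    (hT : ∀ a ∈ T, m ≤ a ∧ a < n) (hmn : m ≤ n) :
    ‖walshCoeff b n h k‖ ≤ ‖walshCoeff b m h k‖ * ∏ a ∈ T, ‖digitCoeff b a h (natDigit b k a)‖ := by
  rw [walshCoeff, walshCoeff, norm_prod, norm_prod, ← Finset.prod_union]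
  · refine Finset.prod_le_prod_of_subset_of_le_one (fun a ha => ?_) (fun _ _ => norm_nonneg _)
      fun _ _ _ => norm_digitCoeff_le_one ..
    rcases Finset.mem_union.mp ha with ha | ha
    · exact Finset.mem_range.mpr ((Finset.mem_range.mp ha).trans_le hmn)
    · exact Finset.mem_range.mpr (hT a ha).2
  · rw [Finset.disjoint_left]
    intro a ha haT
    have := (hT a haT).1
    have := Finset.mem_range.mp ha
    omega

/-- The constant in the decay estimate for Walsh coefficients. -/
def decayConst (b α : ℕ) : ℝ := (2 * Real.pi * b + 1) ^ α * (b : ℝ) ^ (α + 1)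

/-- At `m` both bounds `1` and `2πb y`, with `y = |h| / b ^ (m + 1)`, are used: together they give
`(2πb + 1) y / (1 + y)`. The gained denominator makes the later sum over `h` converge. -/
theorem prod_norm_digitCoeff_le {b k m : ℕ} [NeZero b] {h : ℤ} {T : Finset ℕ} (hm : m ∈ T)
    (hT : ∀ a ∈ T, natDigit b k a ≠ 0) :
    ∏ a ∈ T, ‖digitCoeff b a h (natDigit b k a)‖ ≤
      (∏ a ∈ T, ((2 * Real.pi * b + 1) * |(h : ℝ)| / (b : ℝ) ^ (a + 1))) /
        (1 + |(h : ℝ)| / (b : ℝ) ^ (m + 1)) := by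
  have hb : (0 : ℝ) < b := by exact_mod_cast NeZero.pos b
  have hF : ∀ a ∈ T, ‖digitCoeff b a h (natDigit b k a)‖ ≤
      (2 * Real.pi * b) * |(h : ℝ)| / (b : ℝ) ^ (a + 1) := fun a ha => by
    refine (norm_digitCoeff_le b a h (hT a ha) (natDigit_lt b k a)).trans_eq ?_
    rw [pow_succ]; field_simp
  rw [le_div_iff₀ (by positivity), ← Finset.mul_prod_erase _ _ hm, ← Finset.mul_prod_erase _ _ hm,
    mul_right_comm]
  gcongr with a ha
  · have h1 := hF m hm
    have h2 := norm_digitCoeff_le_one b m h (natDigit b k m)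
    have h3 : 0 ≤ |(h : ℝ)| / (b : ℝ) ^ (m + 1) := by positivity
    calc _ = ‖digitCoeff b m h (natDigit b k m)‖ +
          ‖digitCoeff b m h (natDigit b k m)‖ * (|(h : ℝ)| / (b : ℝ) ^ (m + 1)) := by ring
      _ ≤ (2 * Real.pi * b) * |(h : ℝ)| / (b : ℝ) ^ (m + 1) +
          1 * (|(h : ℝ)| / (b : ℝ) ^ (m + 1)) := by gcongr
      _ = _ := by ring
  · refine (hF a (Finset.mem_of_mem_erase ha)).trans ?_
    gcongr
    linarith

/-- The decay of `‖walshCoeff b n h k‖ / |h| ^ α`. The factor `walshCoeff b m h k`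
is periodic in `h` modulo `b ^ m`. -/
theorem exists_norm_walshCoeff_decay {b α n k : ℕ} [NeZero b] (hb : 2 ≤ b) (hα : 1 ≤ α)
    (hk0 : k ≠ 0) (hk : k < b ^ n) :
    ∃ m : ℕ, ∀ h : ℤ, h ≠ 0 → (|(h : ℝ)| ^ α)⁻¹ * ‖walshCoeff b n h k‖ ≤
      decayConst b α * rRingRing2 b α k *
        (‖walshCoeff b m h k‖ / (1 + |(h : ℝ)| / (b : ℝ) ^ m)) := by
  obtain ⟨T, m, hm, hT, hcard, hlow, hmu⟩ := exists_muRing_eq hb hα hk0 hk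
  refine ⟨m, fun h hh => ?_⟩
  have hbR : (0 : ℝ) < b := by exact_mod_cast NeZero.pos b
  have hbR1 : (1 : ℝ) ≤ b := by exact_mod_cast NeZero.pos b
  have hHpos : 0 < |(h : ℝ)| := by positivity
  have hle := norm_walshCoeff_le (b := b) (n := n) (m := m) h k (T := T)
    (fun a ha => ⟨(hT a ha).1, (hT a ha).2.1⟩) ((hT m hm).2.1.le)
  by_cases hA : walshCoeff b m h k = 0
  · rw [hA, norm_zero, zero_mul] at hle
    rw [hA, le_antisymm hle (norm_nonneg _)]
    simp
  have hprod := prod_norm_digitCoeff_le (b := b) (k := k) (h := h) hm (fun a ha => (hT a ha).2.2)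
  set H := |(h : ℝ)| with hH
  set t := T.card with ht
  -- When `#k < α`, all digits below `m` vanish, so a nonzero periodic factor forces `b ^ m ∣ h`.
  have hHm : t < α → (b : ℝ) ^ m ≤ H := fun hlt => by
    have hdvd := pow_dvd_of_walshCoeff_ne_zero (hlow hlt) hA
    have := Int.le_of_dvd (abs_pos.mpr hh) ((dvd_abs _ _).mpr hdvd)
    rw [hH]
    exact_mod_cast this
  have hpow : ((b : ℝ) ^ (m + 1)) ^ (α - t) ≤ (H * b) ^ (α - t) := by
    rcases hcard.lt_or_eq with hlt | heq
    · have := hHm hlt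
      rw [pow_succ]
      gcongr
    · simp [heq]
  have hinv : (H ^ α)⁻¹ ≤ (H ^ t)⁻¹ * (b ^ (α - t) * (((b : ℝ) ^ (m + 1)) ^ (α - t))⁻¹) := by
    have h1 : H ^ α = H ^ t * H ^ (α - t) := by rw [← pow_add]; congr 1; omega
    rw [h1, mul_inv]
    gcongr
    rw [inv_le_iff_one_le_mul₀ (by positivity), mul_assoc, mul_comm _ (H ^ (α - t)), ← mul_assoc,
      ← div_eq_mul_inv, one_le_div (by positivity), mul_comm, ← mul_pow]
    exact hpow
  have hP : ∏ a ∈ T, ((2 * Real.pi * b + 1) * H / (b : ℝ) ^ (a + 1)) =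
      (2 * Real.pi * b + 1) ^ t * H ^ t * ((b : ℝ) ^ (∑ a ∈ T, (a + 1)))⁻¹ := by
    rw [Finset.prod_div_distrib, Finset.prod_const, Finset.prod_pow_eq_pow_sum, mul_pow,
      div_eq_mul_inv]
  have hx : (1 + H / (b : ℝ) ^ (m + 1))⁻¹ ≤ b * (1 + H / (b : ℝ) ^ m)⁻¹ := by
    rw [← div_eq_mul_inv, ← one_div, div_le_div_iff₀ (by positivity) (by positivity), pow_succ]
    have : (b : ℝ) * (1 + H / ((b : ℝ) ^ m * b)) = b + H / (b : ℝ) ^ m := by field_simp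
    rw [this]
    linarith
  have hr : rRingRing2 b α k =
      ((b : ℝ) ^ (∑ a ∈ T, (a + 1)))⁻¹ * (((b : ℝ) ^ (m + 1)) ^ (α - t))⁻¹ := by
    rw [rRingRing2, hmu, pow_add, mul_inv, ← pow_mul, mul_comm (m + 1)]
  -- The factor `b ^ (α - t)` comes from replacing `b ^ m` by `b ^ (m + 1)` in `hpow`, and the last
  -- `b` from `hx`.
  have hconst : (2 * Real.pi * b + 1) ^ t * (b : ℝ) ^ (α - t) * b ≤ decayConst b α := by
    rw [decayConst, mul_assoc, ← pow_succ]
    have : (1 : ℝ) ≤ 2 * Real.pi * b + 1 := by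
      have : 0 ≤ 2 * Real.pi * b := by positivity
      linarith
    gcongr
    omega
  calc (H ^ α)⁻¹ * ‖walshCoeff b n h k‖
      ≤ (H ^ t)⁻¹ * (b ^ (α - t) * (((b : ℝ) ^ (m + 1)) ^ (α - t))⁻¹) *
        (‖walshCoeff b m h k‖ * (((2 * Real.pi * b + 1) ^ t * H ^ t *
          ((b : ℝ) ^ (∑ a ∈ T, (a + 1)))⁻¹) * (b * (1 + H / (b : ℝ) ^ m)⁻¹))) := by
        gcongr
        refine hle.trans ?_
        gcongr
        refine hprod.trans ?_
        rw [hP, div_eq_mul_inv]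
        gcongr
    _ = ((2 * Real.pi * b + 1) ^ t * (b : ℝ) ^ (α - t) * b) * rRingRing2 b α k *
        (‖walshCoeff b m h k‖ / (1 + H / (b : ℝ) ^ m)) := by
        rw [hr]; field_simp
    _ ≤ _ := by
        have := (rRingRing2_pos hb α k).le
        gcongr

/-- The sum `∑_{q ∈ ℤ} max(1, |q|) ^ (-2)`. -/
def blockConst : ℝ := ∑' q : ℤ, (max 1 |(q : ℝ)| ^ 2)⁻¹

theorem summable_block : Summable fun q : ℤ => (max 1 |(q : ℝ)| ^ 2)⁻¹ := by
  have h := (Real.summable_one_div_int_pow (p := 2)).mpr one_lt_two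
  have h2 : Summable fun q : ℤ => if q = 0 then (1 : ℝ) else 0 :=
    (hasSum_ite_eq 0 1).summable
  refine (h.add h2).of_nonneg_of_le (fun q => by positivity) fun q => ?_
  by_cases hq : q = 0
  · simp [hq]
  · have : (0 : ℝ) < |(q : ℝ)| := by positivity
    rw [if_neg hq, add_zero, one_div, ← sq_abs (q : ℝ)]
    gcongr
    exact le_max_right _ _

/-- Write `h = r + b ^ m q` with `0 ≤ r < b ^ m`. The coefficient depends only on `r` and has square
sum one over a period, while `1 + |h| / b ^ m ≥ max 1 |q|`. -/
theorem walshCoeff_block (b m k : ℕ) [NeZero b] :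
    (Summable fun h : ℤ => ‖walshCoeff b m h k‖ ^ 2 * ((1 + |(h : ℝ)| / (b : ℝ) ^ m) ^ 2)⁻¹) ∧
    ∑' h : ℤ, ‖walshCoeff b m h k‖ ^ 2 * ((1 + |(h : ℝ)| / (b : ℝ) ^ m) ^ 2)⁻¹ ≤ blockConst := by
  have hN : NeZero (b ^ m) := inferInstance
  have hbN : (0 : ℝ) < (b : ℝ) ^ m := by
    have : (0 : ℝ) < b := by exact_mod_cast NeZero.pos b
    positivity
  let E := (Int.divModEquiv (b ^ m)).symm
  let G : ℤ × Fin (b ^ m) → ℝ := fun x =>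
    (max 1 |(x.1 : ℝ)| ^ 2)⁻¹ * ‖walshCoeff b m ((x.2 : ℕ) : ℤ) k‖ ^ 2
  have hfin : HasSum (fun r : Fin (b ^ m) => ‖walshCoeff b m ((r : ℕ) : ℤ) k‖ ^ 2) 1 := by
    have h1 := hasSum_fintype fun r : Fin (b ^ m) => ‖walshCoeff b m ((r : ℕ) : ℤ) k‖ ^ 2
    rwa [Fin.sum_univ_eq_sum_range (fun r : ℕ => ‖walshCoeff b m (r : ℤ) k‖ ^ 2),
      sum_norm_sq_walshCoeff] at h1
  have hG : Summable G := summable_block.mul_of_nonneg hfin.summable (fun q => by positivity)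
    fun r => by positivity
  have hGsum : ∑' x, G x = blockConst := by
    rw [← summable_block.tsum_mul_tsum hfin.summable hG, hfin.tsum_eq, mul_one, blockConst]
  have hle : ∀ x, ‖walshCoeff b m (E x) k‖ ^ 2 * ((1 + |((E x : ℤ) : ℝ)| / (b : ℝ) ^ m) ^ 2)⁻¹ ≤
      G x := by
    rintro ⟨q, r⟩
    have hE : E (q, r) = ((r : ℕ) : ℤ) + (b : ℤ) ^ m * q := by
      simp only [E, Int.divModEquiv_symm_apply]
      push_cast
      ring
    have hr : ((r : ℕ) : ℝ) < (b : ℝ) ^ m := by exact_mod_cast r.2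
    have hr0 : (0 : ℝ) ≤ ((r : ℕ) : ℝ) := Nat.cast_nonneg _
    rw [hE, walshCoeff_add_mul, mul_comm]
    have h1 : max 1 |(q : ℝ)| ≤
        1 + |((((r : ℕ) : ℤ) + (b : ℤ) ^ m * q : ℤ) : ℝ)| / (b : ℝ) ^ m := by
      refine max_le (by linarith [(by positivity :
        0 ≤ |((((r : ℕ) : ℤ) + (b : ℤ) ^ m * q : ℤ) : ℝ)| / (b : ℝ) ^ m)]) ?_
      push_cast
      have h2 : |(b : ℝ) ^ m * q| ≤ |((r : ℕ) : ℝ) + (b : ℝ) ^ m * q| + (r : ℕ) := by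
        have := abs_sub (((r : ℕ) : ℝ) + (b : ℝ) ^ m * q) (r : ℕ)
        rwa [add_sub_cancel_left, abs_of_nonneg hr0] at this
      rw [abs_mul, abs_of_pos hbN] at h2
      rw [← sub_le_iff_le_add', le_div_iff₀ hbN]
      nlinarith
    simp only [G]
    gcongr
  have hs := hG.of_nonneg_of_le (fun x => by positivity) hle
  refine ⟨(E.summable_iff).mp hs, ?_⟩
  rw [← E.tsum_eq, ← hGsum]
  exact hs.tsum_mono hG hle

/-- The sum `∑_h h ^ (-2α) |ĉ(h, k)|²` over nonzero integers, where `ĉ(h, k)` are the Walsh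
coefficients of `x ↦ e(h x)` for `x` rounded down to `n` digits. -/
def walshMass (b α n k : ℕ) : ℝ := ∑' h : ℤ, ((h : ℝ) ^ (2 * α))⁻¹ * ‖walshCoeff b n h k‖ ^ 2

theorem summable_inv_pow {α : ℕ} (hα : 1 ≤ α) : Summable fun h : ℤ => ((h : ℝ) ^ (2 * α))⁻¹ := by
  simpa using (Real.summable_one_div_int_pow (p := 2 * α)).mpr (by omega)

theorem inv_pow_two_mul_nonneg (α : ℕ) (h : ℤ) : 0 ≤ ((h : ℝ) ^ (2 * α))⁻¹ :=
  inv_nonneg.mpr ((even_two_mul α).pow_nonneg _)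

theorem summable_walshMass (b n k : ℕ) [NeZero b] {α : ℕ} (hα : 1 ≤ α) :
    Summable fun h : ℤ => ((h : ℝ) ^ (2 * α))⁻¹ * ‖walshCoeff b n h k‖ ^ 2 := by
  refine (summable_inv_pow hα).of_nonneg_of_le
    (fun h => mul_nonneg (inv_pow_two_mul_nonneg α h) (by positivity)) fun h => ?_
  exact mul_le_of_le_one_right (inv_pow_two_mul_nonneg α h)
    (pow_le_one₀ (norm_nonneg _) (norm_walshCoeff_le_one ..))

theorem walshMass_nonneg (b α n k : ℕ) : 0 ≤ walshMass b α n k :=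
  tsum_nonneg fun h => mul_nonneg (inv_pow_two_mul_nonneg α h) (by positivity)

theorem walshMass_le {b α n k : ℕ} [NeZero b] (hb : 2 ≤ b) (hα : 1 ≤ α) (hk0 : k ≠ 0)
    (hk : k < b ^ n) :
    walshMass b α n k ≤ decayConst b α ^ 2 * blockConst * rRing2 b α k := by
  obtain ⟨m, hm⟩ := exists_norm_walshCoeff_decay hb hα hk0 hk
  obtain ⟨hs, hle⟩ := walshCoeff_block b m k
  have h1 : ∀ h : ℤ, ((h : ℝ) ^ (2 * α))⁻¹ * ‖walshCoeff b n h k‖ ^ 2 ≤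
      (decayConst b α * rRingRing2 b α k) ^ 2 *
        (‖walshCoeff b m h k‖ ^ 2 * ((1 + |(h : ℝ)| / (b : ℝ) ^ m) ^ 2)⁻¹) := fun h => by
    by_cases hh : h = 0
    · subst hh
      rw [Int.cast_zero, zero_pow (by omega), inv_zero, zero_mul]
      positivity
    · have h2 := pow_le_pow_left₀ (by positivity) (hm h hh) 2
      have h3 : ((h : ℝ) ^ (2 * α))⁻¹ = ((|(h : ℝ)| ^ α)⁻¹) ^ 2 := by
        rw [inv_pow, ← pow_mul, mul_comm α, pow_mul |(h : ℝ)|, sq_abs, pow_mul]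
      rw [h3, ← mul_pow]
      refine h2.trans_eq ?_
      rw [mul_pow, div_pow, div_eq_mul_inv]
  calc walshMass b α n k ≤ _ := (summable_walshMass b n k hα).tsum_mono (hs.mul_left _) h1
    _ ≤ (decayConst b α * rRingRing2 b α k) ^ 2 * blockConst := by
        rw [tsum_mul_left]; gcongr
    _ = _ := by rw [rRing2_eq_sq]; ring

/-- Only multiples of `b ^ n` contribute, and for them `h ^ (-2α) ≤ h ^ (-4) ≤ b ^ (-2n) h ^ (-2)`.
-/
theorem walshMass_zero_le {b α n : ℕ} [NeZero b] (hα : 2 ≤ α) :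
    walshMass b α n 0 ≤ (((b : ℝ) ^ n) ^ 2)⁻¹ * ∑' h : ℤ, ((h : ℝ) ^ (2 * 1))⁻¹ := by
  have hb1 : (1 : ℝ) ≤ b := by exact_mod_cast NeZero.pos b
  have hN : (1 : ℝ) ≤ (b : ℝ) ^ n := one_le_pow₀ hb1
  rw [← tsum_mul_left]
  refine (summable_walshMass b n 0 (by omega)).tsum_mono
    ((summable_inv_pow le_rfl).mul_left _) fun h => ?_
  by_cases hh : h = 0
  · subst hh; simp [show α ≠ 0 by omega]
  by_cases hc : walshCoeff b n h 0 = 0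
  · simp only [hc, norm_zero]
    have := inv_pow_two_mul_nonneg 1 h
    simp only [ne_eq, OfNat.ofNat_ne_zero, not_false_eq_true, zero_pow, mul_zero]
    positivity
  have hdvd := pow_dvd_of_walshCoeff_ne_zero (fun j _ => by simp [natDigit]) hc
  have hle := Int.le_of_dvd (abs_pos.mpr hh) ((dvd_abs _ _).mpr hdvd)
  have hle' : (b : ℝ) ^ n ≤ |(h : ℝ)| := by exact_mod_cast hle
  have h1 : ‖walshCoeff b n h 0‖ ^ 2 ≤ 1 := pow_le_one₀ (norm_nonneg _) (norm_walshCoeff_le_one ..)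
  refine (mul_le_of_le_one_right (inv_pow_two_mul_nonneg α h) h1).trans ?_
  rw [← mul_inv]
  have hpos : 0 < |(h : ℝ)| := by positivity
  have e1 : (h : ℝ) ^ (2 * α) = |(h : ℝ)| ^ (2 * α) := by rw [pow_mul, pow_mul, sq_abs]
  have e2 : (h : ℝ) ^ (2 * 1) = |(h : ℝ)| ^ 2 := by rw [mul_one, sq_abs]
  rw [e1, e2]
  gcongr
  calc ((b : ℝ) ^ n) ^ 2 * |(h : ℝ)| ^ 2 ≤ |(h : ℝ)| ^ 2 * |(h : ℝ)| ^ 2 := by gcongr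
    _ = |(h : ℝ)| ^ 4 := by ring
    _ ≤ _ := pow_le_pow_right₀ (hN.trans hle') (by omega)

/-! ### Walsh kernels -/

theorem sum_mul_re_mul_conj {X : Type} (a : X →₀ ℝ) (u : X → ℂ) :
    ∑ x ∈ a.support, ∑ y ∈ a.support, a x * a y * (u x * (starRingEnd ℂ) (u y)).re =
      ‖∑ x ∈ a.support, (a x : ℂ) * u x‖ ^ 2 := by
  have h : ((‖∑ x ∈ a.support, (a x : ℂ) * u x‖ ^ 2 : ℝ) : ℂ) =
      ∑ x ∈ a.support, ∑ y ∈ a.support, ((a x * a y : ℝ) : ℂ) * (u x * (starRingEnd ℂ) (u y)) := by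
    rw [← Complex.normSq_eq_norm_sq, ← Complex.mul_conj, map_sum, Finset.sum_mul_sum]
    refine Finset.sum_congr rfl fun x _ => Finset.sum_congr rfl fun y _ => ?_
    rw [map_mul, Complex.conj_ofReal]
    push_cast
    ring
  have h2 := congrArg Complex.re h
  rw [Complex.ofReal_re] at h2
  rw [h2]
  simp only [Complex.re_sum, Complex.re_ofReal_mul]

/-- The transform `k ↦ ∑ₓ a(x) wal_k(x)` of a finitely supported function. -/
def walshTransform (b : ℕ) [NeZero b] (a : I →₀ ℝ) (k : ℕ) : ℂ :=
  ∑ x ∈ a.support, (a x : ℂ) * wal b k (Real.digits x b)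

theorem summable_walshTerm {b : ℕ} [NeZero b] (hb : 2 ≤ b) {r : ℕ → ℝ} (hr0 : ∀ k, 0 ≤ r k)
    (hr : Summable r) (x x' : ℝ) : Summable (walshTerm b r x x') := by
  refine Summable.of_norm ?_
  have h : ∀ k : ℕ+, ‖walshTerm b r x x' k‖ = r k := fun k => by
    rw [walshTerm, norm_mul, norm_wal hb, mul_one, Complex.norm_real,
      Real.norm_of_nonneg (hr0 _)]
  simp only [h]
  exact hr.comp_injective PNat.coe_injective

theorem walshKernel_comm {b : ℕ} [NeZero b] (hb : 2 ≤ b) (r : ℕ → ℝ) (x x' : ℝ) :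
    walshKernel b r x x' = walshKernel b r x' x := by
  have h : ∀ k, walshTerm b r x x' k = (starRingEnd ℂ) (walshTerm b r x' x k) := fun k => by
    rw [walshTerm, walshTerm, digitSub, digitSub, wal_sub hb, wal_sub hb]
    simp [mul_comm]
  rw [walshKernel, walshKernel, tsum_congr h, ← Complex.conj_tsum, Complex.conj_re]

/-- A family over the positive integers has the same sum as its extension by zero to `ℕ`. -/
theorem hasSum_pnat_iff {M : Type*} [AddCommMonoid M] [TopologicalSpace M] (f : ℕ → M) (s : M) :
    HasSum (fun k : ℕ+ => f k) s ↔ HasSum (fun k : ℕ => if k = 0 then 0 else f k) s := by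
  rw [← PNat.coe_injective.hasSum_iff (f := fun k : ℕ => if k = 0 then 0 else f k)]
  · refine iff_of_eq (congrArg (fun g => HasSum g s) (funext fun k => ?_))
    simp
  · intro k hk
    rw [if_pos]
    by_contra hk0
    exact hk ⟨⟨k, Nat.pos_of_ne_zero hk0⟩, rfl⟩

theorem hasSum_quadForm_walshKernel {b : ℕ} [NeZero b] (hb : 2 ≤ b) {r : ℕ → ℝ}
    (hr0 : ∀ k, 0 ≤ r k) (hr : Summable r) (a : I →₀ ℝ) :
    HasSum (fun k : ℕ => if k = 0 then 0 else r k * ‖walshTransform b a k‖ ^ 2)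
      (quadForm (onI (walshKernel b r)) a) := by
  rw [← hasSum_pnat_iff fun k : ℕ => r k * ‖walshTransform b a k‖ ^ 2]
  have h1 : ∀ x y : I, HasSum (fun k : ℕ+ => a x * a y * (walshTerm b r x y k).re)
      (a x * a y * walshKernel b r x y) := fun x y =>
    (Complex.hasSum_re (summable_walshTerm hb hr0 hr x y).hasSum).mul_left _
  have h2 := hasSum_sum fun x (_ : x ∈ a.support) => hasSum_sum fun y (_ : y ∈ a.support) => h1 x y
  refine h2.congr_fun fun k => ?_
  rw [walshTransform, ← sum_mul_re_mul_conj, Finset.mul_sum]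
  refine Finset.sum_congr rfl fun x _ => ?_
  rw [Finset.mul_sum]
  refine Finset.sum_congr rfl fun y _ => ?_
  rw [walshTerm, digitSub, wal_sub hb, Complex.re_ofReal_mul]
  ring

theorem isSPSD_walshKernel {b : ℕ} [NeZero b] (hb : 2 ≤ b) {r : ℕ → ℝ} (hr0 : ∀ k, 0 ≤ r k)
    (hr : Summable r) : IsSPSD (walshKernel b r) := by
  refine posSemidef_of_quadForm_nonneg (fun x y => walshKernel_comm hb r x y) fun a => ?_
  refine (hasSum_quadForm_walshKernel hb hr0 hr a).nonneg fun k => ?_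
  have := hr0 k
  split_ifs <;> positivity

theorem exists_neg_digits (b n : ℕ) [NeZero b] : ∃ ν : Fin (b ^ n) ≃ Fin (b ^ n),
    ∀ k, ∀ j < n, natDigit b (ν k) j = (b - natDigit b k j) % b := by
  let E : (Fin n → Fin b) ≃ Fin (b ^ n) := finFunctionFinEquiv
  have hE : ∀ k : Fin (b ^ n), ∀ j (hj : j < n), natDigit b k j = (E.symm k ⟨j, hj⟩ : ℕ) :=
    fun _ _ _ => rfl
  refine ⟨(E.symm.trans (Equiv.neg _)).trans E, fun k j hj => ?_⟩
  rw [hE _ j hj, hE _ j hj]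
  simp only [Equiv.trans_apply, Equiv.symm_apply_apply, Equiv.neg_apply, Pi.neg_apply, Fin.val_neg']

/-- Conjugation turns `wal_k` into the Walsh function of the digitwise negative of `k`. This
negation permutes the `k < b ^ n` and keeps the positions of nonzero digits, so the sum equals its
conjugate. -/
theorem im_sum_walsh_eq_zero {b : ℕ} [NeZero b] (hb : 2 ≤ b) {r : ℕ → ℝ} {n : ℕ}
    (hr : ∀ k l, k < b ^ n → l < b ^ n →
      (∀ j < n, natDigit b k j = 0 ↔ natDigit b l j = 0) → r k = r l) (d : ℕ → Fin b) :
    (∑ k ∈ Finset.range (b ^ n), (r k : ℂ) * wal b k d).im = 0 := by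
  obtain ⟨ν, hν⟩ := exists_neg_digits b n
  have hwal : ∀ k : Fin (b ^ n), (starRingEnd ℂ) ((r k : ℂ) * wal b k d) =
      (r (ν k : ℕ) : ℂ) * wal b (ν k : ℕ) d := fun k => by
    have hrk : r k = r (ν k : ℕ) := hr _ _ k.2 (ν k).2 fun j hj => by
      have hlt := natDigit_lt b k j
      rw [hν k j hj]
      constructor
      · intro h0; simp [h0]
      · intro h0
        by_contra hne
        rw [Nat.mod_eq_of_lt (by omega)] at h0
        omega
    rw [map_mul, Complex.conj_ofReal, hrk, wal_eq_prod hb k.2, wal_eq_prod hb (ν k).2, map_prod]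
    congr 1
    refine Finset.prod_congr rfl fun j hj => ?_
    have hlt := natDigit_lt b k j
    rw [hν k j (Finset.mem_range.mp hj), conj_e, mul_comm (((b - natDigit b k j) % b : ℕ) : ℝ),
      e_mul_mod_div, Nat.cast_sub hlt.le]
    symm
    refine e_eq_of_sub_intCast ((d j : ℕ) : ℤ) ?_
    have hbR : (b : ℝ) ≠ 0 := by exact_mod_cast NeZero.ne b
    rw [Int.cast_natCast]
    field_simp
    ring
  rw [← Complex.conj_eq_iff_im, map_sum,
    ← Fin.sum_univ_eq_sum_range (fun k => (starRingEnd ℂ) ((r k : ℂ) * wal b k d)),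
    ← Fin.sum_univ_eq_sum_range (fun k => (r k : ℂ) * wal b k d), Finset.sum_congr rfl
      fun k _ => hwal k]
  exact ν.sum_comp fun k : Fin (b ^ n) => (r k : ℂ) * wal b k d

/-- A Walsh series whose weights depend only on the positions of the nonzero digits has a
real sum. -/
theorem hasSum_walshTerm {b : ℕ} [NeZero b] (hb : 2 ≤ b) {r : ℕ → ℝ} (hr0 : ∀ k, 0 ≤ r k)
    (hr : Summable r) (hsymm : ∀ n k l, k < b ^ n → l < b ^ n →
      (∀ j < n, natDigit b k j = 0 ↔ natDigit b l j = 0) → r k = r l) (x x' : ℝ) :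
    HasSum (walshTerm b r x x') (walshKernel b r x x' : ℂ) := by
  have hs := (summable_walshTerm hb hr0 hr x x').hasSum
  have him : (∑' k, walshTerm b r x x' k).im = 0 := by
    let r' : ℕ → ℝ := fun k => if k = 0 then 0 else r k
    have hs' : HasSum (fun k : ℕ => (r' k : ℂ) * wal b k (digitSub b x x'))
        (∑' k, walshTerm b r x x' k) := by
      refine ((hasSum_pnat_iff (fun k : ℕ => (r k : ℂ) * wal b k (digitSub b x x')) _).mp
        hs).congr_fun fun k => ?_
      simp only [r']
      split_ifs <;> simp
    have ht := (Complex.continuous_im.tendsto _).comp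
      (hs'.tendsto_sum_nat.comp (tendsto_pow_atTop_atTop_of_one_lt (by omega : 1 < b)))
    refine tendsto_nhds_unique ht (tendsto_const_nhds.congr fun n => ?_)
    refine (im_sum_walsh_eq_zero hb (fun k l hk hl h => ?_) _).symm
    have hkl : k = 0 ↔ l = 0 := by
      have h0 : ∀ i < b ^ n, i = 0 ↔ ∀ j < n, natDigit b i j = 0 := fun i hi => by
        constructor
        · rintro rfl j _; simp [natDigit]
        · intro hz
          exact eq_of_natDigit_eq hi (Nat.pow_pos (by omega)) fun j hj => by
            rw [hz j hj]; simp [natDigit]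
      rw [h0 k hk, h0 l hl]
      exact forall₂_congr h
    simp only [r', hkl, hsymm n k l hk hl h]
  have hre : (walshKernel b r x x' : ℂ) = ∑' k, walshTerm b r x x' k :=
    Complex.ext rfl (by rw [him, Complex.ofReal_im])
  rw [hre]
  exact hs

/-! ### The Korobov kernel -/

/-- The function of `x - x'` defining the Korobov kernel. -/
def korobovFun (α : ℕ) (t : ℝ) : ℝ :=
  ∑' h : ℤ, ((h : ℝ) ^ (2 * α))⁻¹ * Real.cos (2 * Real.pi * h * t)

theorem summable_korobovFun {α : ℕ} (hα : 1 ≤ α) (t : ℝ) :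
    Summable fun h : ℤ => ((h : ℝ) ^ (2 * α))⁻¹ * Real.cos (2 * Real.pi * h * t) := by
  refine Summable.of_norm_bounded (summable_inv_pow hα) fun h => ?_
  rw [norm_mul, Real.norm_of_nonneg (inv_pow_two_mul_nonneg α h)]
  exact mul_le_of_le_one_right (inv_pow_two_mul_nonneg α h) (Real.abs_cos_le_one _)

/-- The index `h = 0` may be included because `(0 ^ (2 * α))⁻¹ = 0`. -/
theorem korobov_eq {α : ℕ} (hα : 1 ≤ α) (x x' : ℝ) : korobov α x x' = korobovFun α (x - x') := by
  rw [korobov, korobovFun]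
  refine tsum_subtype_eq_of_support_subset (s := {k : ℤ | k ≠ 0})
    (f := fun h : ℤ => ((h : ℝ) ^ (2 * α))⁻¹ * Real.cos (2 * Real.pi * h * (x - x'))) fun h hh => ?_
  rintro rfl
  simp [show α ≠ 0 by omega] at hh

theorem continuous_korobovFun {α : ℕ} (hα : 1 ≤ α) : Continuous (korobovFun α) := by
  refine continuous_tsum (fun h => by fun_prop) (summable_inv_pow hα) fun h t => ?_
  rw [norm_mul, Real.norm_of_nonneg (inv_pow_two_mul_nonneg α h)]
  exact mul_le_of_le_one_right (inv_pow_two_mul_nonneg α h) (Real.abs_cos_le_one _)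

theorem abs_korobovFun_le {α : ℕ} (hα : 1 ≤ α) (t : ℝ) :
    |korobovFun α t| ≤ ∑' h : ℤ, ((h : ℝ) ^ (2 * α))⁻¹ := by
  rw [← Real.norm_eq_abs, korobovFun]
  refine tsum_of_norm_bounded (summable_inv_pow hα).hasSum fun h => ?_
  rw [norm_mul, Real.norm_of_nonneg (inv_pow_two_mul_nonneg α h)]
  exact mul_le_of_le_one_right (inv_pow_two_mul_nonneg α h) (Real.abs_cos_le_one _)

theorem korobov_comm {α : ℕ} (x x' : ℝ) : korobov α x x' = korobov α x' x := by
  rw [korobov, korobov]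
  refine tsum_congr fun k => ?_
  rw [← Real.cos_neg]
  ring_nf

/-- The quadratic form of the Korobov kernel at the points `p x`. -/
theorem hasSum_quadForm_korobov {X : Type} {α : ℕ} (hα : 1 ≤ α) (p : X → ℝ) (a : X →₀ ℝ) :
    HasSum (fun h : ℤ => ((h : ℝ) ^ (2 * α))⁻¹ * ‖∑ x ∈ a.support, (a x : ℂ) * e (h * p x)‖ ^ 2)
      (quadForm (fun x y => korobov α (p x) (p y)) a) := by
  have h1 : ∀ x y : X, HasSum (fun h : ℤ => a x * a y *
      (((h : ℝ) ^ (2 * α))⁻¹ * Real.cos (2 * Real.pi * h * (p x - p y))))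
      (a x * a y * korobov α (p x) (p y)) := fun x y => by
    rw [korobov_eq hα]
    exact (summable_korobovFun hα _).hasSum.mul_left _
  have h2 := hasSum_sum fun x (_ : x ∈ a.support) => hasSum_sum fun y (_ : y ∈ a.support) => h1 x y
  refine h2.congr_fun fun h => ?_
  rw [← sum_mul_re_mul_conj, Finset.mul_sum]
  refine Finset.sum_congr rfl fun x _ => ?_
  rw [Finset.mul_sum]
  refine Finset.sum_congr rfl fun y _ => ?_
  rw [conj_e, ← e_add, re_e]
  ring_nf

theorem isSPSD_korobov {α : ℕ} (hα : 1 ≤ α) : IsSPSD (korobov α) := by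
  refine posSemidef_of_quadForm_nonneg (fun x y => korobov_comm _ _) fun a => ?_
  exact (hasSum_quadForm_korobov hα (fun x : I => (x : ℝ)) a).nonneg fun h =>
    mul_nonneg (inv_pow_two_mul_nonneg α h) (by positivity)

/-- The real number with the first `n` digits given by `d` and all further digits zero. -/
def trunc {b : ℕ} (n : ℕ) (d : ℕ → Fin b) : ℝ := ∑ j ∈ Finset.range n, Real.ofDigitsTerm d j

theorem tendsto_trunc {b : ℕ} (d : ℕ → Fin b) :
    Tendsto (fun n => trunc n d) atTop (𝓝 (Real.ofDigits d)) :=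
  Real.summable_ofDigitsTerm.hasSum.tendsto_sum_nat

theorem tendsto_korobov_trunc {b α : ℕ} (hα : 1 ≤ α) (d d' : ℕ → Fin b) :
    Tendsto (fun n => korobov α (trunc n d) (trunc n d')) atTop
      (𝓝 (korobov α (Real.ofDigits d) (Real.ofDigits d'))) := by
  simp only [korobov_eq hα]
  exact ((continuous_korobovFun hα).tendsto _).comp ((tendsto_trunc d).sub (tendsto_trunc d'))

theorem tendsto_quadForm {X : Type} {K : ℕ → X → X → ℝ} {K' : X → X → ℝ}
    (h : ∀ x y, Tendsto (fun n => K n x y) atTop (𝓝 (K' x y))) (a : X →₀ ℝ) :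
    Tendsto (fun n => quadForm (K n) a) atTop (𝓝 (quadForm K' a)) :=
  tendsto_finsetSum _ fun x _ => tendsto_finsetSum _ fun y _ => (h x y).const_mul _

theorem sum_mul_e_trunc {b : ℕ} [NeZero b] (hb : 2 ≤ b) (n : ℕ) (h : ℤ) (a : I →₀ ℝ)
    (d : ℕ → Fin b) :
    ∑ x ∈ a.support, (a x : ℂ) * e (h * trunc n (Real.digits x b + d)) =
      ∑ k ∈ Finset.range (b ^ n), walshCoeff b n h k * walshTransform b a k * wal b k d := by
  have h1 : ∀ k ∈ Finset.range (b ^ n),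
      walshCoeff b n h k * walshTransform b a k * wal b k d =
        ∑ x ∈ a.support, (a x : ℂ) * (walshCoeff b n h k * wal b k (Real.digits x b + d)) :=
    fun k _ => by
    rw [walshTransform, Finset.mul_sum, Finset.sum_mul]
    refine Finset.sum_congr rfl fun x _ => ?_
    rw [wal_add hb]
    ring
  rw [Finset.sum_congr rfl h1, Finset.sum_comm]
  refine Finset.sum_congr rfl fun x _ => ?_
  rw [trunc, e_trunc_eq_sum hb, Finset.mul_sum]

theorem wal_zero_digits {b : ℕ} [NeZero b] (hb : 2 ≤ b) (k : ℕ) : wal b k 0 = 1 := by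
  rw [wal_eq_prod hb (Nat.lt_pow_self (n := k) (by omega))]
  simp [e_zero]

/-! ### Comparison of the Korobov kernel with Walsh kernels -/

/-- Isolates the index `k = 0`, which the Walsh kernel lacks; `c` will be `b ^ (-n)`. -/
theorem sum_walshTransform_le {b : ℕ} [NeZero b] (hb : 2 ≤ b) {r : ℕ → ℝ} (hr0 : ∀ k, 0 ≤ r k)
    (hr : Summable r) (a : I →₀ ℝ) (n : ℕ) (c : ℝ) :
    ∑ k ∈ Finset.range (b ^ n), (if k = 0 then c else r k) * ‖walshTransform b a k‖ ^ 2 ≤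
      c * ‖walshTransform b a 0‖ ^ 2 + quadForm (onI (walshKernel b r)) a := by
  have h1 := sum_le_hasSum (Finset.range (b ^ n)) (fun k _ => by
    have := hr0 k
    split_ifs <;> positivity) (hasSum_quadForm_walshKernel hb hr0 hr a)
  have h2 : ∀ k ∈ Finset.range (b ^ n),
      (if k = 0 then c else r k) * ‖walshTransform b a k‖ ^ 2 =
      (if k = 0 then c * ‖walshTransform b a 0‖ ^ 2 else 0) +
        (if k = 0 then 0 else r k * ‖walshTransform b a k‖ ^ 2) := fun k _ => by
    by_cases hk : k = 0 <;> simp [hk]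
  rw [Finset.sum_congr rfl h2, Finset.sum_add_distrib, Finset.sum_ite_eq',
    if_pos (Finset.mem_range.mpr (Nat.pow_pos (by omega)))]
  linarith

theorem tendsto_inv_pow_mul_add {b : ℕ} (hb : 2 ≤ b) (u v : ℝ) :
    Tendsto (fun n : ℕ => ((b : ℝ) ^ n)⁻¹ * u + v) atTop (𝓝 v) := by
  have h1 : Tendsto (fun n : ℕ => ((b : ℝ) ^ n)⁻¹) atTop (𝓝 0) :=
    (tendsto_pow_atTop_atTop_of_one_lt (by exact_mod_cast (by omega : 1 < b))).inv_tendsto_atTop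
  simpa using (h1.mul_const u).add_const v

theorem quadForm_korobov_le {b α : ℕ} [NeZero b] (hb : 2 ≤ b) (hα : 2 ≤ α) :
    ∃ C, 0 ≤ C ∧ ∀ a, quadForm (onI (korobov α)) a ≤ C * quadForm (onI (kRingRing b α)) a := by
  set Z := ∑' h : ℤ, ((h : ℝ) ^ (2 * 1))⁻¹ with hZ
  have hZ0 : 0 ≤ Z := tsum_nonneg fun h => inv_pow_two_mul_nonneg 1 h
  set D := decayConst b α ^ 2 * blockConst with hD
  have hD0 : 0 ≤ D := mul_nonneg (by positivity) (tsum_nonneg fun q => by positivity)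
  have hbR : (1 : ℝ) ≤ b := by exact_mod_cast NeZero.pos b
  refine ⟨Z + D * 5, by positivity, fun a => ?_⟩
  have hlim : Tendsto (fun n => quadForm (fun x y : I =>
      korobov α (trunc n (Real.digits x b)) (trunc n (Real.digits y b))) a) atTop
      (𝓝 (quadForm (onI (korobov α)) a)) := tendsto_quadForm (fun x y => by
    have := tendsto_korobov_trunc (α := α) (by omega) (Real.digits x b) (Real.digits y b)
    rwa [Real.ofDigits_digits (by omega) x.2, Real.ofDigits_digits (by omega) y.2] at this) a
  have hlim2 := (tendsto_inv_pow_mul_add hb (‖walshTransform b a 0‖ ^ 2)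
    (quadForm (onI (kRingRing b α)) a)).const_mul (Z + D * 5)
  refine le_of_tendsto_of_tendsto' hlim hlim2 fun n => ?_
  have hN : (1 : ℝ) ≤ (b : ℝ) ^ n := one_le_pow₀ hbR
  -- Cauchy–Schwarz weights. The value `b ^ (-n)` at `k = 0` tends to zero, yet stays large against
  -- the mass `O(b ^ (-2n))` there.
  let s : ℕ → ℝ := fun k => if k = 0 then ((b : ℝ) ^ n)⁻¹ else rRingRing2 b α k
  have hs : ∀ k, 0 < s k := fun k => by
    have := rRingRing2_pos hb α k
    simp only [s]; split_ifs <;> positivity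
  have hq := hasSum_quadForm_korobov (α := α) (by omega)
    (fun x : I => trunc n (Real.digits x b)) a
  have hterm : ∀ h : ℤ, ((h : ℝ) ^ (2 * α))⁻¹ *
      ‖∑ x ∈ a.support, (a x : ℂ) * e (h * trunc n (Real.digits x b))‖ ^ 2 ≤
      (∑ k ∈ Finset.range (b ^ n), (s k)⁻¹ *
        (((h : ℝ) ^ (2 * α))⁻¹ * ‖walshCoeff b n h k‖ ^ 2)) *
      ∑ k ∈ Finset.range (b ^ n), s k * ‖walshTransform b a k‖ ^ 2 := fun h => by
    have h1 := sum_mul_e_trunc hb n h a 0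
    simp only [add_zero, wal_zero_digits hb, mul_one] at h1
    rw [h1]
    have h2 : ‖∑ k ∈ Finset.range (b ^ n), walshCoeff b n h k * walshTransform b a k‖ ^ 2 ≤
        (∑ k ∈ Finset.range (b ^ n), (s k)⁻¹ * ‖walshCoeff b n h k‖ ^ 2) *
        ∑ k ∈ Finset.range (b ^ n), s k * ‖walshTransform b a k‖ ^ 2 := by
      refine (pow_le_pow_left₀ (norm_nonneg _) (norm_sum_le _ _) 2).trans ?_
      refine Finset.sum_sq_le_sum_mul_sum_of_sq_le_mul _
        (fun k _ => by have := hs k; positivity) (fun k _ => by have := hs k; positivity)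
        fun k _ => le_of_eq ?_
      have := (hs k).ne'
      rw [norm_mul]
      field_simp
    refine (mul_le_mul_of_nonneg_left h2 (inv_pow_two_mul_nonneg α h)).trans_eq ?_
    rw [← mul_assoc]
    congr 1
    rw [Finset.mul_sum]
    exact Finset.sum_congr rfl fun k _ => by ring
  have hmass : HasSum (fun h : ℤ => (∑ k ∈ Finset.range (b ^ n), (s k)⁻¹ *
        (((h : ℝ) ^ (2 * α))⁻¹ * ‖walshCoeff b n h k‖ ^ 2)) *
      ∑ k ∈ Finset.range (b ^ n), s k * ‖walshTransform b a k‖ ^ 2)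
      ((∑ k ∈ Finset.range (b ^ n), (s k)⁻¹ * walshMass b α n k) *
      ∑ k ∈ Finset.range (b ^ n), s k * ‖walshTransform b a k‖ ^ 2) :=
    (hasSum_sum fun k _ => (summable_walshMass b n k (by omega)).hasSum.mul_left _).mul_right _
  have hmain := hasSum_le hterm hq hmass
  have hsum1 : ∑ k ∈ Finset.range (b ^ n), (s k)⁻¹ * walshMass b α n k ≤ Z + D * 5 := by
    have h3 : ∀ k ∈ Finset.range (b ^ n), (s k)⁻¹ * walshMass b α n k ≤
        (if k = 0 then Z else 0) + D * rRingRing2 b α k := fun k hk => by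
      have hpos := rRingRing2_pos hb α k
      by_cases hk0 : k = 0
      · subst hk0
        simp only [s, if_true, inv_inv]
        have h4 : (b : ℝ) ^ n * walshMass b α n 0 ≤ Z := by
          calc (b : ℝ) ^ n * walshMass b α n 0 ≤ (b : ℝ) ^ n * ((((b : ℝ) ^ n) ^ 2)⁻¹ * Z) := by
                gcongr; exact walshMass_zero_le hα
            _ = ((b : ℝ) ^ n)⁻¹ * Z := by field_simp
            _ ≤ Z := mul_le_of_le_one_left hZ0 (inv_le_one_of_one_le₀ hN)
        have h5 : 0 ≤ D * rRingRing2 b α 0 := by positivity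
        linarith
      · simp only [s, hk0, if_false, zero_add]
        have h4 := walshMass_le (α := α) hb (by omega) hk0 (Finset.mem_range.mp hk)
        rw [rRing2_eq_sq] at h4
        calc (rRingRing2 b α k)⁻¹ * walshMass b α n k
            ≤ (rRingRing2 b α k)⁻¹ * (D * rRingRing2 b α k ^ 2) := by gcongr
          _ = _ := by field_simp
    refine (Finset.sum_le_sum h3).trans ?_
    rw [Finset.sum_add_distrib, Finset.sum_ite_eq',
      if_pos (Finset.mem_range.mpr (Nat.pow_pos (by omega))), ← Finset.mul_sum]
    gcongr
    exact sum_range_pow_rRingRing2_le hb hα n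
  have hsum2 := sum_walshTransform_le hb (fun k => (rRingRing2_pos hb α k).le)
    (summable_rRingRing2 hb hα) a n ((b : ℝ) ^ n)⁻¹
  refine hmain.trans ?_
  have h0 : 0 ≤ ∑ k ∈ Finset.range (b ^ n), s k * ‖walshTransform b a k‖ ^ 2 :=
    Finset.sum_nonneg fun k _ => by have := hs k; positivity
  exact mul_le_mul hsum1 hsum2 h0 (by positivity)

/-! ### The digitally-shift-invariant kernel -/

theorem digits_eq_gridDigits {b : ℕ} [NeZero b] (n : ℕ) (σ : ℝ) {j : ℕ} (hj : j < n) :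
    Real.digits σ b j = gridDigits b n ⌊σ * (b : ℝ) ^ n⌋₊ j := by
  have hb : (b : ℝ) ≠ 0 := by exact_mod_cast NeZero.ne b
  have h1 : σ * (b : ℝ) ^ (j + 1) = σ * (b : ℝ) ^ n / ((b ^ (n - 1 - j) : ℕ) : ℝ) := by
    have : (b : ℝ) ^ n = (b : ℝ) ^ (j + 1) * (b : ℝ) ^ (n - 1 - j) := by
      rw [← pow_add]; congr 1; omega
    rw [this]
    push_cast
    field_simp
  rw [Real.digits, gridDigits, h1, Nat.floor_div_natCast]

theorem trunc_congr {b n : ℕ} {d d' : ℕ → Fin b} (h : ∀ j < n, d j = d' j) :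
    trunc n d = trunc n d' :=
  Finset.sum_congr rfl fun j hj => by
    rw [Real.ofDigitsTerm, Real.ofDigitsTerm, h j (Finset.mem_range.mp hj)]

theorem integral_comp_floor {N : ℕ} (hN : 0 < N) (ψ : ℕ → ℝ) :
    ∫ σ in (0 : ℝ)..1, ψ ⌊σ * N⌋₊ = (N : ℝ)⁻¹ * ∑ q ∈ Finset.range N, ψ q := by
  have hNR : (0 : ℝ) < N := by exact_mod_cast hN
  have hEq : ∀ q : ℕ, Set.EqOn (fun σ : ℝ => ψ ⌊σ * N⌋₊) (fun _ => ψ q)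
      (Set.Ioo ((q : ℝ) / N) (((q + 1 : ℕ) : ℝ) / N)) := fun q σ hσ => by
    have h1 : ⌊σ * N⌋₊ = q := by
      rw [Nat.floor_eq_iff (mul_nonneg ((by positivity : (0 : ℝ) ≤ (q : ℝ) / N).trans hσ.1.le)
        hNR.le)]
      exact ⟨((div_lt_iff₀ hNR).mp hσ.1).le, by
        have := (lt_div_iff₀ hNR).mp hσ.2
        push_cast at this; exact this⟩
    simp only [h1]
  have hle : ∀ q : ℕ, (q : ℝ) / N ≤ ((q + 1 : ℕ) : ℝ) / N := fun q => by
    gcongr; simp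
  have hint : ∀ q < N, IntervalIntegrable (fun σ : ℝ => ψ ⌊σ * N⌋₊) volume
      ((q : ℝ) / N) (((q + 1 : ℕ) : ℝ) / N) := fun q _ => by
    refine (intervalIntegrable_const (c := ψ q)).congr_uIoo ?_
    rw [Set.uIoo_of_le (hle q)]
    exact (hEq q).symm
  have h := intervalIntegral.sum_integral_adjacent_intervals (a := fun q : ℕ => (q : ℝ) / N) hint
  simp only [Nat.cast_zero, zero_div, div_self hNR.ne'] at h
  rw [← h, Finset.mul_sum]
  refine Finset.sum_congr rfl fun q _ => ?_
  rw [intervalIntegral.integral_congr_Ioo_of_le (hle q) (hEq q), intervalIntegral.integral_const,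
    smul_eq_mul]
  push_cast
  ring

/-- The digital shift by the points of a grid approximates the shift-invariant kernel. -/
theorem tendsto_dsi {b α : ℕ} [NeZero b] (hb : 2 ≤ b) (hα : 1 ≤ α) (x x' : ℝ) :
    Tendsto (fun n => ((b : ℝ) ^ n)⁻¹ * ∑ q ∈ Finset.range (b ^ n),
        korobov α (trunc n (Real.digits x b + gridDigits b n q))
          (trunc n (Real.digits x' b + gridDigits b n q))) atTop
      (𝓝 (dsi b (korobov α) x x')) := by
  have h1 : ∀ n, ((b : ℝ) ^ n)⁻¹ * ∑ q ∈ Finset.range (b ^ n),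
        korobov α (trunc n (Real.digits x b + gridDigits b n q))
          (trunc n (Real.digits x' b + gridDigits b n q)) =
      ∫ σ in (0 : ℝ)..1, korobov α (trunc n (Real.digits x b + gridDigits b n ⌊σ * (b : ℝ) ^ n⌋₊))
          (trunc n (Real.digits x' b + gridDigits b n ⌊σ * (b : ℝ) ^ n⌋₊)) := fun n => by
    have := integral_comp_floor (N := b ^ n) (Nat.pow_pos (by omega)) fun q =>
      korobov α (trunc n (Real.digits x b + gridDigits b n q))
          (trunc n (Real.digits x' b + gridDigits b n q))
    push_cast at this
    exact this.symm
  simp only [h1]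
  rw [dsi]
  -- Truncating the digit sequence of `x ⊕ σ`, not the number, gives convergence even if it ends in
  -- digits `b - 1`. The kernel is bounded, so limit and integral commute.
  refine intervalIntegral.tendsto_integral_filter_of_dominated_convergence
    (fun _ => ∑' h : ℤ, ((h : ℝ) ^ (2 * α))⁻¹) (Eventually.of_forall fun n => ?_)
    (Eventually.of_forall fun n => Eventually.of_forall fun σ _ => ?_) intervalIntegrable_const
    (Eventually.of_forall fun σ _ => ?_)
  · refine Measurable.aestronglyMeasurable ?_
    exact (measurable_from_nat (f := fun q => korobov α
      (trunc n (Real.digits x b + gridDigits b n q))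
      (trunc n (Real.digits x' b + gridDigits b n q)))).comp
      (Nat.measurable_floor.comp (measurable_id.mul_const _))
  · rw [korobov_eq hα, Real.norm_eq_abs]
    exact abs_korobovFun_le hα _
  · have h2 := tendsto_korobov_trunc hα (Real.digits x b + Real.digits σ b)
      (Real.digits x' b + Real.digits σ b)
    refine h2.congr fun n => ?_
    congr 1 <;> exact trunc_congr fun j hj => by
      rw [Pi.add_apply, Pi.add_apply, digits_eq_gridDigits n σ hj]

theorem quadForm_const_mul_sum {X ι : Type} (c : ℝ) (s : Finset ι) (K : ι → X → X → ℝ)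
    (a : X →₀ ℝ) :
    quadForm (fun x y => c * ∑ i ∈ s, K i x y) a = c * ∑ i ∈ s, quadForm (K i) a := by
  simp only [quadForm]
  rw [Finset.sum_comm (s := s), Finset.mul_sum]
  refine Finset.sum_congr rfl fun x _ => ?_
  rw [Finset.sum_comm (s := s), Finset.mul_sum]
  refine Finset.sum_congr rfl fun y _ => ?_
  rw [← Finset.mul_sum]
  ring

/-- The average of the Korobov kernel over the shifts by grid points is diagonal in the Walsh
functions. -/
theorem quadForm_average_korobov {b α : ℕ} [NeZero b] (hb : 2 ≤ b) (hα : 1 ≤ α) (n : ℕ)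
    (a : I →₀ ℝ) :
    quadForm (fun x y : I => ((b : ℝ) ^ n)⁻¹ * ∑ q ∈ Finset.range (b ^ n),
        korobov α (trunc n (Real.digits x b + gridDigits b n q))
          (trunc n (Real.digits y b + gridDigits b n q))) a =
      ∑ k ∈ Finset.range (b ^ n), walshMass b α n k * ‖walshTransform b a k‖ ^ 2 := by
  have hbR : (b : ℝ) ^ n ≠ 0 := pow_ne_zero _ (by exact_mod_cast NeZero.ne b)
  have h1 := (hasSum_sum fun q (_ : q ∈ Finset.range (b ^ n)) => hasSum_quadForm_korobov hα
    (fun x : I => trunc n (Real.digits x b + gridDigits b n q)) a).mul_left ((b : ℝ) ^ n)⁻¹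
  have h2 : HasSum (fun h : ℤ => ∑ k ∈ Finset.range (b ^ n),
      ((h : ℝ) ^ (2 * α))⁻¹ * ‖walshCoeff b n h k‖ ^ 2 * ‖walshTransform b a k‖ ^ 2)
      (∑ k ∈ Finset.range (b ^ n), walshMass b α n k * ‖walshTransform b a k‖ ^ 2) :=
    hasSum_sum fun k _ => (summable_walshMass b n k hα).hasSum.mul_right _
  rw [quadForm_const_mul_sum ((b : ℝ) ^ n)⁻¹ (Finset.range (b ^ n)) fun q (x y : I) =>
    korobov α (trunc n (Real.digits x b + gridDigits b n q))
      (trunc n (Real.digits y b + gridDigits b n q))]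
  refine h1.unique (h2.congr_fun fun h => ?_)
  simp only [sum_mul_e_trunc hb]
  -- For fixed `h` the shifted sums form a Walsh polynomial on the grid; Parseval removes all cross
  -- terms.
  rw [← Finset.mul_sum, sum_norm_sq_walsh_gridDigits hb n
    fun k => walshCoeff b n h k * walshTransform b a k, mul_left_comm,
    inv_mul_cancel_left₀ hbR, Finset.mul_sum]
  refine Finset.sum_congr rfl fun k _ => ?_
  rw [norm_mul]
  ring

theorem tendsto_quadForm_dsi {b α : ℕ} [NeZero b] (hb : 2 ≤ b) (hα : 1 ≤ α) (a : I →₀ ℝ) :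
    Tendsto (fun n => ∑ k ∈ Finset.range (b ^ n), walshMass b α n k * ‖walshTransform b a k‖ ^ 2)
      atTop (𝓝 (quadForm (onI (dsi b (korobov α))) a)) := by
  simp only [← quadForm_average_korobov hb hα]
  exact tendsto_quadForm (fun x y : I => tendsto_dsi hb hα (x : ℝ) y) a

theorem isSPSD_dsi_korobov {b α : ℕ} [NeZero b] (hb : 2 ≤ b) (hα : 1 ≤ α) :
    IsSPSD (dsi b (korobov α)) := by
  refine posSemidef_of_quadForm_nonneg (fun x y => ?_) fun a => ?_
  · simp only [onI, dsi, korobov_comm (digitAdd b x _)]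
  · exact ge_of_tendsto' (tendsto_quadForm_dsi hb hα a) fun n => Finset.sum_nonneg fun k _ =>
      mul_nonneg (walshMass_nonneg b α n k) (by positivity)

theorem quadForm_dsi_korobov_le {b α : ℕ} [NeZero b] (hb : 2 ≤ b) (hα : 2 ≤ α) :
    ∃ C, 0 ≤ C ∧
      ∀ a, quadForm (onI (dsi b (korobov α))) a ≤ C * quadForm (onI (kRing b α)) a := by
  set Z := ∑' h : ℤ, ((h : ℝ) ^ (2 * 1))⁻¹ with hZ
  have hZ0 : 0 ≤ Z := tsum_nonneg fun h => inv_pow_two_mul_nonneg 1 h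
  set D := decayConst b α ^ 2 * blockConst with hD
  have hD0 : 0 ≤ D := mul_nonneg (by positivity) (tsum_nonneg fun q => by positivity)
  have hbR : (1 : ℝ) ≤ b := by exact_mod_cast NeZero.pos b
  -- Both forms are diagonal here, so the comparison is termwise: `D` serves `k ≠ 0` and `Z` serves
  -- `k = 0`.
  refine ⟨Z + D, by positivity, fun a => ?_⟩
  have hr0 : ∀ k, 0 ≤ rRing2 b α k := fun k => by rw [rRing2_eq_sq]; positivity
  refine le_of_tendsto_of_tendsto' (tendsto_quadForm_dsi hb (by omega) a)
    ((tendsto_inv_pow_mul_add hb (‖walshTransform b a 0‖ ^ 2)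
      (quadForm (onI (kRing b α)) a)).const_mul (Z + D)) fun n => ?_
  have hN : (1 : ℝ) ≤ (b : ℝ) ^ n := one_le_pow₀ hbR
  have hsum := sum_walshTransform_le hb hr0 (summable_rRing2 hb hα) a n ((b : ℝ) ^ n)⁻¹
  refine le_trans ?_ (mul_le_mul_of_nonneg_left hsum (by positivity))
  rw [Finset.mul_sum]
  refine Finset.sum_le_sum fun k hk => ?_
  rw [← mul_assoc]
  gcongr
  by_cases hk0 : k = 0
  · subst hk0
    rw [if_pos rfl]
    calc walshMass b α n 0 ≤ (((b : ℝ) ^ n) ^ 2)⁻¹ * Z := walshMass_zero_le hα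
      _ ≤ ((b : ℝ) ^ n)⁻¹ * (Z + D) := by
        gcongr
        · exact le_self_pow₀ hN two_ne_zero
        · linarith
      _ = _ := mul_comm _ _
  · rw [if_neg hk0]
    refine (walshMass_le (α := α) hb (by omega) hk0 (Finset.mem_range.mp hk)).trans ?_
    have := hr0 k
    gcongr
    linarith

theorem quadForm_kRing_le {b α : ℕ} [NeZero b] (hb : 2 ≤ b) (hα : 2 ≤ α) (a : I →₀ ℝ) :
    quadForm (onI (kRing b α)) a ≤ 1 * quadForm (onI (kRingRing b α)) a := by
  rw [one_mul]
  refine hasSum_le (fun k => ?_) (hasSum_quadForm_walshKernel hb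
    (fun k => by rw [rRing2_eq_sq]; positivity) (summable_rRing2 hb hα) a)
    (hasSum_quadForm_walshKernel hb (fun k => (rRingRing2_pos hb α k).le)
      (summable_rRingRing2 hb hα) a)
  have := rRing2_le_rRingRing2 hb α k
  split_ifs
  · rfl
  · gcongr

end WalshRKHS

end

open WalshRKHS in
theorem mainTheorem3 (b : ℕ) [Fact b.Prime] (α : ℕ) (hα : 2 ≤ α) :
    -- the two Walsh series converge, with real sums
    (∀ x x' : I, HasSum (walshTerm b (rRing2 b α) x x') (kRing b α x x' : ℂ)) ∧
    (∀ x x' : I, HasSum (walshTerm b (rRingRing2 b α) x x') (kRingRing b α x x' : ℂ)) ∧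
    -- all four kernels are symmetric positive semi-definite, hence have an RKHS
    IsSPSD (korobov α) ∧ IsSPSD (dsi b (korobov α)) ∧
    IsSPSD (kRing b α) ∧ IsSPSD (kRingRing b α) ∧
    -- the inclusions
    H (dsi b (korobov α)) ⊆ H (kRing b α) ∧
    H (kRing b α) ⊆ H (kRingRing b α) ∧
    H (korobov α) ⊆ H (kRingRing b α) := by
  have hb : 2 ≤ b := (Fact.out : b.Prime).two_le
  have hr1 : ∀ k, 0 ≤ rRing2 b α k := fun k => by rw [rRing2_eq_sq]; positivity
  have hr2 : ∀ k, 0 ≤ rRingRing2 b α k := fun k => (rRingRing2_pos hb α k).le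
  have hs1 := summable_rRing2 hb hα
  have hs2 := summable_rRingRing2 hb hα
  have hK1 : IsSPSD (kRing b α) := isSPSD_walshKernel hb hr1 hs1
  have hK2 : IsSPSD (kRingRing b α) := isSPSD_walshKernel hb hr2 hs2
  obtain ⟨C₁, hC₁, h₁⟩ := quadForm_dsi_korobov_le hb hα
  obtain ⟨C₂, hC₂, h₂⟩ := quadForm_korobov_le hb hα
  refine ⟨fun x x' => hasSum_walshTerm hb hr1 hs1 (fun n k l hk hl h => ?_) x x',
    fun x x' => hasSum_walshTerm hb hr2 hs2 (fun n k l hk hl h => ?_) x x',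
    isSPSD_korobov (by omega), isSPSD_dsi_korobov hb (by omega), hK1, hK2,
    rkhs_subset_of_quadForm_le hK1 hC₁ h₁,
    rkhs_subset_of_quadForm_le hK2 zero_le_one (quadForm_kRing_le hb hα),
    rkhs_subset_of_quadForm_le hK2 hC₂ h₂⟩
  · rw [rRing2, rRing2, muRing_congr hb α hk hl h]
  · rw [rRingRing2, rRingRing2, muRing_congr hb α hk hl h]
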